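/- **Setting.** Consider the single-input single-output closed loop $e=r-Gu$, $q=Ke$, $u=R(q)$ with real finite-dimensional linear systems $G(s)$, $K(s)$ (proper, with given state-space realizations with state matrices $A_G,A_K$) and a reset element $R$: $\dot x=A_Rx+B_Rq$, $u=C_Rx+D_Rq$ between resets, and $x\mapsto A_\rho x$ at a reset, which happens at zeros of $q$; the value of a signal at a reset instant is the one just before the reset. The feed-through loop is well posed, $1+D_GD_RD_K\ne0$. Put $$R_L(s)=C_R(sI-A_R)^{-1}B_R+D_R,\quad R^X_L(s)=(sI-A_R)^{-1}B_R,\quad R^X_\delta(s)=(sI-A_R)^{-1}(A_\rho-I),\quad R_\delta(s)=C_RR^X_\delta(s),$$ $$S_L=(1+GR_LK)^{-1},\qquad Q_\delta=KS_LGR_\delta,\qquad H=R^X_\delta-R^X_LKS_LGR_\delta .$$ Let $(A_Q,B_Q,C_Q)$ and $(A_H,B_H,C_H)$ be state-space matrices of $Q_\delta$ and $H$, with $A_Q$ and $A_H$ asymptotically stable (Hurwitz). Let $\omega>0$ and $r(t)=|R_I|\sin(\omega t+\angle R_I)$, $R_I\in\mathbb C$. Assume that for every odd $k\ge1$ the point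 $jk\omega$ is not an eigenvalue of $A_R$, $A_G$ or $A_K$ and that $1+G(jk\omega)R_L(jk\omega)K(jk\omega)\neq0$. Write $\kappa=K(j\omega)S_L(j\omega)R_I$, $\Sigma_A=\sum_{p\in\{2,4,6,\dots\}}\bigl(e^{Ap\pi/\omega}-e^{A(p-1)\pi/\omega}\bigr)$ for $A\in\{A_Q,A_H\}$, $\Lambda=\omega^2I+A_R^2$, $\Delta=I+e^{A_R\pi/\omega}$, $\Delta_D=I+A_\rho e^{A_R\pi/\omega}$, and $\Theta=-\tfrac{2\omega^2}{\pi}\Delta\bigl(\Delta_D^{-1}A_\rho\Delta\Lambda^{-1}-\Lambda^{-1}\bigr)$. Define, for a reset state $x$ and an angle $\varphi$, $$\Phi(x)=\sin^{-1}\!\Bigl(\frac{C_Q\Sigma_{A_Q}B_Q\,x}{|\kappa|}\Bigr),\qquad \Psi(\varphi,n)=|\kappa|\,e^{\,nj\angle\kappa+nj\varphi},\qquad B^\star(x)=\frac1{\omega|\kappa|}\Delta^{-1}\Lambda\,(I+e^{A_R\pi/\omega}A_\rho)\,x,$$ $$R^\star_{DF,n}(B)=\begin{cases}C_R(jn\omega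 I-A_R)^{-1}j\Theta B,& n \text{ odd}\\ 0,& n\text{ even}\end{cases}$$ (the part due to the resets of the higher-order sinusoidal-input describing function), and $$\mathcal E_n(x,\varphi)=S_L(jn\omega)\times\begin{cases}R_I-G(j\omega)R^\star_{DF,1}(B^\star(x))\,\Psi(\varphi,1),&n=1\\-G(jn\omega)R^\star_{DF,n}(B^\star(x))\,\Psi(\varphi,n),&n>1.\end{cases}$$ Let $$\hat x=\Bigl[I+\Lambda^{-1}A_RB_RC_Q\Sigma_{A_Q}B_Q-C_H\Sigma_{A_H}B_H\Bigr]^{-1}\Lambda^{-1}\omega B_R\,|\kappa|,\qquad \hat\Phi=\Phi(\hat x),$$ where the bracketed matrix and $\Delta_D$ are assumed invertible. **Theorem.** Consider a periodic response of the closed loop, all of whose states satisfy $x(t+\pi/\omega)=-x(t)$, that is reset exactly at the instants $t_\rho+p\pi/\omega$, $p\in\mathbb Z$ (two modelled resets per period), where $q$ vanishes. Suppose that $q$ is descending at $t_\rho$, $\dot q(t_\rho^-)<0$, and that $\operatorname{sign}\dot q(t_\rho^-)=\operatorname{sign}\dot q_L(t_\rho)$ for the base linear response $q_L(t)=|\kappa|\sin(\omega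 t+\angle\kappa)$. Let $x(t_\rho)$ be the reset element's state just before the reset, $\Phi=\Phi(x(t_\rho))$, and let $E_n(\omega)$ be the phasor of the $n$-th harmonic of $e$, that is, the $n$-th Fourier component of $e$ is $|E_n|\sin(n\omega t+\angle E_n)$. Then: 1. $E_n(\omega)=\mathcal E_n(x(t_\rho),\Phi)$ for all $n\ge1$, exactly. 2. The analytical reset state is correct to second order in $\Phi$: $|x(t_\rho)_i-\hat x_i|\le\frac{\Phi^2}{2}|\hat x_i|$ for every component $i$. 3. If the phase shift is small, $|\Phi|\le\pi/4$, then the analytical solution $\mathcal E_n(\hat x,\hat\Phi)$, which involves no unknown of the response, approximates the harmonic error response to second order in $\Phi$: for all $n\ge1$ $$\bigl|E_n(\omega)-\mathcal E_n(\hat x,\hat\Phi)\bigr|\le\Bigl(\frac{\Phi^2}2+2n|\Phi|^3\Bigr)\,\bigl|S_L(jn\omega)G(jn\omega)R^\star_{DF,n}(B^\star(\hat x))\Psi(\hat\Phi,n)\bigr| .$$ -/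

import Mathlib

open Matrix

noncomputable section

namespace ResetControl

variable {ι γ κ ν : Type*} [Fintype ι] [DecidableEq ι] [Fintype γ] [DecidableEq γ]
  [Fintype κ] [DecidableEq κ] [Fintype ν] [DecidableEq ν]

/-- A real single-input single-output state-space system `x' = A x + B u`, `y = C x + D u`. -/
structure SISO (κ : Type*) where
  A : Matrix κ κ ℝ
  B : κ → ℝ
  C : κ → ℝ
  D : ℝ

/-- A real matrix seen as a complex one. -/
abbrev toC {μ ν : Type*} (A : Matrix μ ν ℝ) : Matrix μ ν ℂ := A.map Complex.ofReal

/-- A real vector seen as a complex one. -/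
abbrev toCv {μ : Type*} (v : μ → ℝ) : μ → ℂ := fun i => (v i : ℂ)

/-- The complex matrix `s I - A`. -/
def pencil (A : Matrix κ κ ℝ) (s : ℂ) : Matrix κ κ ℂ := s • (1 : Matrix κ κ ℂ) - toC A

/-- The transfer function `C (s I - A)⁻¹ B + D`. -/
def SISO.tf (P : SISO κ) (s : ℂ) : ℂ :=
  toCv P.C ⬝ᵥ ((pencil P.A s)⁻¹ *ᵥ toCv P.B) + P.D

/-- All (complex) eigenvalues of the real matrix `A` have negative real part. -/
def Hurwitz (A : Matrix κ κ ℝ) : Prop := ∀ z ∈ spectrum ℂ (toC A), z.re < 0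

/-- A closed-loop reset control system: a reset element with base linear dynamics `R` and reset
matrix `Aρ`, a linear system `G` behind it and a linear filter `K` in front of it.  The
interconnection is `e = r - G u`, `q = K e`, `u = R q`; the reset element's state is multiplied by
`Aρ` when `q` crosses zero. -/
structure ResetLoop (ι γ κ : Type*) where
  R : SISO ι
  Aρ : Matrix ι ι ℝ
  G : SISO γ
  K : SISO κ

namespace ResetLoop

/-! ### Time domain -/

/-- The algebraic loop formed by the direct feed-throughs is well posed. -/
def WellPosed (S : ResetLoop ι γ κ) : Prop := 1 + S.G.D * S.R.D * S.K.D ≠ 0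

/-- A trajectory on the whole time axis of the closed loop with reference `r`, reset at the
instants in `T` (all of which are zeros of `q`).  The signals are left-continuous, so that `xR t`
at a reset instant `t` is the state just before the reset.  Zeros of `q` outside `T` are
crossings at which the reset is not modelled; `T = {t | q t = 0}` is the unabridged reset law. -/
structure Trajectory (S : ResetLoop ι γ κ) (r : ℝ → ℝ) (T : Set ℝ) where
  xR : ℝ → ι → ℝ
  xG : ℝ → γ → ℝ
  xK : ℝ → κ → ℝ
  e : ℝ → ℝ
  q : ℝ → ℝ
  u : ℝ → ℝ
  e_eq : ∀ t, e t = r t - (S.G.C ⬝ᵥ xG t + S.G.D * u t)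
  q_eq : ∀ t, q t = S.K.C ⬝ᵥ xK t + S.K.D * e t
  u_eq : ∀ t, u t = S.R.C ⬝ᵥ xR t + S.R.D * q t
  flowR : ∀ t ∉ T, HasDerivAt xR (S.R.A *ᵥ xR t + q t • S.R.B) t
  flowG : ∀ t ∉ T, HasDerivAt xG (S.G.A *ᵥ xG t + u t • S.G.B) t
  flowK : ∀ t ∉ T, HasDerivAt xK (S.K.A *ᵥ xK t + e t • S.K.B) t
  leftR : ∀ t ∈ T, ContinuousWithinAt xR (Set.Iic t) t
  contG : ∀ t ∈ T, ContinuousAt xG t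
  contK : ∀ t ∈ T, ContinuousAt xK t
  zero : ∀ t ∈ T, q t = 0
  jump : ∀ t ∈ T, Filter.Tendsto xR (nhdsWithin t (Set.Ioi t)) (nhds (S.Aρ *ᵥ xR t))

/-- The steady-state symmetry `x (t + π / ω) = - x t` (hence period `2 π / ω`) of all states. -/
def Trajectory.HalfWavePeriodic {S : ResetLoop ι γ κ} {r : ℝ → ℝ} {T : Set ℝ}
    (X : S.Trajectory r T) (ω : ℝ) : Prop :=
  ∀ t, X.xR (t + Real.pi / ω) = -X.xR t ∧ X.xG (t + Real.pi / ω) = -X.xG t ∧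
    X.xK (t + Real.pi / ω) = -X.xK t

end ResetLoop

/-- The sinusoid `|P| sin (ω t + ∠ P)` with phasor `P`. -/
def sinusoid (P : ℂ) (ω t : ℝ) : ℝ := ‖P‖ * Real.sin (ω * t + P.arg)

/-- Two reset instants per period `2 π / ω`: `{t₀ + p π / ω | p ∈ ℤ}`. -/
def resetInstants (ω t₀ : ℝ) : Set ℝ := {t | ∃ p : ℤ, t = t₀ + p * (Real.pi / ω)}

/-- The phasor `E_n` of the `n`-th harmonic, `n ≥ 1`, of a `2 π / ω`-periodic signal: the signal's
`n`-th Fourier component is `|E_n| sin (n ω t + ∠ E_n)`. -/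
def harmonic (e : ℝ → ℝ) (ω : ℝ) (n : ℕ) : ℂ :=
  Complex.I * ω / Real.pi *
    ∫ t in (0 : ℝ)..(2 * Real.pi / ω), (e t : ℂ) * Complex.exp (-(Complex.I * n * ω * t))

/-- The point `j n ω` of the imaginary axis. -/
def jw (ω : ℝ) (n : ℕ) : ℂ := Complex.I * n * ω

/-- `∑_{p ∈ {2, 4, 6, …}} (exp (A p π / ω) - exp (A (p - 1) π / ω))`. -/
def altSum (A : Matrix ν ν ℝ) (ω : ℝ) : Matrix ν ν ℝ :=
  ∑' k : ℕ, (NormedSpace.exp (((2 * k + 2 : ℝ) * Real.pi / ω) • A)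
    - NormedSpace.exp (((2 * k + 1 : ℝ) * Real.pi / ω) • A))

namespace ResetLoop

/-! ### Frequency domain -/

variable (S : ResetLoop ι γ κ)

/-- The sensitivity of the base linear system, `S_L = (1 + G R_L K)⁻¹`. -/
def SL (s : ℂ) : ℂ := (1 + S.G.tf s * S.R.tf s * S.K.tf s)⁻¹

/-- `R_L^X(s) = (s I - A_R)⁻¹ B_R`, from `q` to the reset element's state. -/
def RXL (s : ℂ) : ι → ℂ := (pencil S.R.A s)⁻¹ *ᵥ toCv S.R.B

/-- `R_δ^X(s) = (s I - A_R)⁻¹ (Aρ - I)`, from the reset impulses to the reset element's state. -/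
def RXδ (s : ℂ) : Matrix ι ι ℂ := (pencil S.R.A s)⁻¹ * toC (S.Aρ - 1)

/-- `R_δ(s) = C_R (s I - A_R)⁻¹ (Aρ - I)`, from the reset impulses to `u`. -/
def Rδ (s : ℂ) : ι → ℂ := toCv S.R.C ᵥ* S.RXδ s

/-- `s` is not an eigenvalue of a component, and `S_L(s)` is finite. -/
def Regular (s : ℂ) : Prop :=
  (pencil S.R.A s).det ≠ 0 ∧ (pencil S.G.A s).det ≠ 0 ∧ (pencil S.K.A s).det ≠ 0 ∧
    1 + S.G.tf s * S.R.tf s * S.K.tf s ≠ 0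

/-- `(A, B, C)` are state-space matrices of `Q_δ(s) = K(s) S_L(s) G(s) R_δ(s)`. -/
def RealizesQ (A : Matrix ν ν ℝ) (B : Matrix ν ι ℝ) (C : ν → ℝ) : Prop :=
  ∀ s : ℂ, S.Regular s → (pencil A s).det ≠ 0 →
    toCv C ᵥ* ((pencil A s)⁻¹ * toC B) = (S.K.tf s * S.SL s * S.G.tf s) • S.Rδ s

/-- `(A, B, C)` are state-space matrices of
`H(s) = R_δ^X(s) - R_L^X(s) K(s) S_L(s) G(s) R_δ(s)`. -/
def RealizesH (A : Matrix ν ν ℝ) (B : Matrix ν ι ℝ) (C : Matrix ι ν ℝ) : Prop :=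
  ∀ s : ℂ, S.Regular s → (pencil A s).det ≠ 0 →
    toC C * ((pencil A s)⁻¹ * toC B) =
      S.RXδ s - (S.K.tf s * S.SL s * S.G.tf s) • vecMulVec (S.RXL s) (S.Rδ s)

/-- The phasor `K(jω) S_L(jω) R_I` of the base linear response of `q`. -/
def qL (ω : ℝ) (RI : ℂ) : ℂ := S.K.tf (jw ω 1) * S.SL (jw ω 1) * RI

/-- `Λ = ω² I + A_R²`. -/
def Λ (ω : ℝ) : Matrix ι ι ℝ := ω ^ 2 • (1 : Matrix ι ι ℝ) + S.R.A ^ 2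

/-- `exp (A_R π / ω)`. -/
def expR (ω : ℝ) : Matrix ι ι ℝ := NormedSpace.exp ((Real.pi / ω) • S.R.A)

/-- `Δ = I + exp (A_R π / ω)`. -/
def Δ (ω : ℝ) : Matrix ι ι ℝ := 1 + S.expR ω

/-- `Δ_D = I + Aρ exp (A_R π / ω)`. -/
def ΔD (ω : ℝ) : Matrix ι ι ℝ := 1 + S.Aρ * S.expR ω

/-- `Γ = Δ_D⁻¹ Aρ Δ Λ⁻¹`. -/
def Γ (ω : ℝ) : Matrix ι ι ℝ := (S.ΔD ω)⁻¹ * S.Aρ * S.Δ ω * (S.Λ ω)⁻¹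

/-- `Θ = - (2 ω² / π) Δ (Γ - Λ⁻¹)`. -/
def Θ (ω : ℝ) : Matrix ι ι ℝ :=
  (-(2 * ω ^ 2 / Real.pi)) • (S.Δ ω * (S.Γ ω - (S.Λ ω)⁻¹))

/-- The part of the higher-order sinusoidal-input describing function of the reset element
that is due to the resets, with input vector `B`: `C_R (j n ω I - A_R)⁻¹ j Θ B` for odd `n`,
zero for even `n`. -/
def RDF (ω : ℝ) (B : ι → ℝ) (n : ℕ) : ℂ :=
  if Odd n then
    toCv S.R.C ⬝ᵥ ((pencil S.R.A (jw ω n))⁻¹ *ᵥ (Complex.I • toCv (S.Θ ω *ᵥ B)))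
  else 0

/-- The virtual input vector `B⋆(ω, x)`: the input vector for which the open-loop reset element,
driven by a sinusoid of amplitude `|K S_L R_I|` and frequency `ω`, has the steady-state reset
state `x` at descending zero crossings of its input. -/
def Bstar (ω : ℝ) (RI : ℂ) (x : ι → ℝ) : ι → ℝ :=
  (ω * ‖S.qL ω RI‖)⁻¹ • (((S.Δ ω)⁻¹ * S.Λ ω * (1 + S.expR ω * S.Aρ)) *ᵥ x)

/-- The phase shift `Φ(ω, x)`. -/
def Φ (AQ : Matrix ν ν ℝ) (BQ : Matrix ν ι ℝ) (CQ : ν → ℝ) (ω : ℝ) (RI : ℂ) (x : ι → ℝ) : ℝ :=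
  Real.arcsin ((CQ ⬝ᵥ ((altSum AQ ω * BQ) *ᵥ x)) * ‖S.qL ω RI‖⁻¹)

/-- `Ψ(ω, n) = |K S_L R_I| exp (n j ∠(K S_L R_I) + n j φ)`. -/
def Ψ (ω : ℝ) (RI : ℂ) (φ : ℝ) (n : ℕ) : ℂ :=
  ‖S.qL ω RI‖ *
    Complex.exp (n * Complex.I * (S.qL ω RI).arg + n * Complex.I * φ)

/-- The matrix inverted in the formula for the reset state. -/
def stateMatrix {μ : Type*} [Fintype μ] [DecidableEq μ]
    (AQ : Matrix ν ν ℝ) (BQ : Matrix ν ι ℝ) (CQ : ν → ℝ)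
    (AH : Matrix μ μ ℝ) (BH : Matrix μ ι ℝ) (CH : Matrix ι μ ℝ) (ω : ℝ) : Matrix ι ι ℝ :=
  1 + (S.Λ ω)⁻¹ * S.R.A * vecMulVec S.R.B (CQ ᵥ* (altSum AQ ω * BQ)) - CH * altSum AH ω * BH

/-- The analytical (small-angle) value of the reset state. -/
def xHat {μ : Type*} [Fintype μ] [DecidableEq μ]
    (AQ : Matrix ν ν ℝ) (BQ : Matrix ν ι ℝ) (CQ : ν → ℝ)
    (AH : Matrix μ μ ℝ) (BH : Matrix μ ι ℝ) (CH : Matrix ι μ ℝ) (ω : ℝ) (RI : ℂ) : ι → ℝ :=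
  ‖S.qL ω RI‖ •
    (((S.stateMatrix AQ BQ CQ AH BH CH ω)⁻¹ * (S.Λ ω)⁻¹) *ᵥ (ω • S.R.B))

/-- The reset contribution `G(j n ω) R⋆_{DF,n}(ω, B⋆(ω, x)) Ψ(ω, n)`. -/
def resetTerm (ω : ℝ) (RI : ℂ) (x : ι → ℝ) (φ : ℝ) (n : ℕ) : ℂ :=
  S.G.tf (jw ω n) * S.RDF ω (S.Bstar ω RI x) n * S.Ψ ω RI φ n

/-- The harmonic error response with reset state `x` and phase shift `φ`. -/
def errorFormula (ω : ℝ) (RI : ℂ) (x : ι → ℝ) (φ : ℝ) (n : ℕ) : ℂ :=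
  S.SL (jw ω n) *
    (if n = 1 then RI - S.resetTerm ω RI x φ 1 else -S.resetTerm ω RI x φ n)

end ResetLoop

end ResetControl

end

open ResetControl

/-! The argument is exact until its last step. Over one half period, integrate every signal against
`exp (-j n ω t)` with `n` odd. This kernel changes sign over `π/ω`, so the boundary terms of an
antiperiodic continuous state cancel, and those of the reset element's state leave only the jump
`(Aρ - I) x`, where `x` is the state before the reset. The loop equations become algebraic
(`exists_lap`): the base linear response plus an impulse of weight `(Aρ - I) x` at `t₀`.

Odd coefficients determine a continuous function on a half period (`eqOn_zero_of_lap_odd_eq_zero`).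
Hence `q` and the reset state are a sinusoid plus the antiperiodic response of the stable
realizations of `-Q_δ` and `H`, whose end value is given by `altSum`
(`Hurwitz.eq_sinusoid_sub_altSum`).

With `θ = ω t₀ + ∠κ`, the condition `q = 0` at a reset reads `|κ| sin θ = C_Q Σ B_Q x`. Descent
gives `cos θ < 0`, so that `Φ = arcsin (sin θ)` satisfies `Φ ≡ π - θ` modulo `2π`. Inserting the
sine into the equation for `x` leaves only the cosine on the right, whence `x = cos Φ • x̂` exactly
(`xR_eq_smul_xHat`). The harmonics of `e` take the stated form because `B⋆` is built so that `|κ| Θ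
B⋆ = -(2ω/π) (Aρ - I) x` (`norm_smul_Θ_mulVec_Bstar`).

By linearity `Φ̂ = arcsin (tan Φ)`. The two error formulas thus differ by the factor `1 - cos Φ ·
exp (j n (Φ - Φ̂))`, and the bounds follow from `1 - cos Φ ≤ Φ²/2` and `cos Φ · |arcsin (tan Φ) - Φ|
≤ 2|Φ|³`. -/

section

open Matrix Set MeasureTheory intervalIntegral

/-! ### Spectra of matrix exponentials and the alternating sum. -/

open scoped Matrix.Norms.Operator in
theorem Matrix.exp_mulVec_of_mulVec_eq_smul {κ : Type*} [Fintype κ] [DecidableEq κ]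
    {A : Matrix κ κ ℂ} {v : κ → ℂ} {z : ℂ} (h : A *ᵥ v = z • v) :
    NormedSpace.exp A *ᵥ v = Complex.exp z • v := by
  have hp : ∀ n : ℕ, (A ^ n) *ᵥ v = z ^ n • v := by
    intro n
    induction n with
    | zero => simp
    | succ n ih =>
      rw [pow_succ, ← mulVec_mulVec, h, mulVec_smul, ih, smul_smul, pow_succ, mul_comm]
  have h1 := NormedSpace.exp_series_hasSum_exp' (𝕂 := ℂ) A
  have h2 := NormedSpace.exp_series_hasSum_exp' (𝕂 := ℂ) z
  rw [← Complex.exp_eq_exp_ℂ] at h2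
  have h3 : HasSum (fun n : ℕ => ((n.factorial : ℂ)⁻¹ • A ^ n) *ᵥ v) (NormedSpace.exp A *ᵥ v) :=
    h1.map ({ toFun := fun M : Matrix κ κ ℂ => M *ᵥ v, map_zero' := zero_mulVec v,
              map_add' := fun M N => add_mulVec M N v } : Matrix κ κ ℂ →+ (κ → ℂ))
      (Continuous.matrix_mulVec continuous_id continuous_const)
  have h4 := h2.smul_const v
  refine h3.unique (h4.congr_fun ?_)
  intro n
  rw [smul_mulVec, hp, smul_assoc]

/-- Since `A` commutes with its exponential, it preserves the eigenspace for `w`. An eigenvector of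
`A` inside that eigenspace supplies `z`. -/
theorem Matrix.exists_mem_spectrum_of_mem_spectrum_exp {κ : Type*} [Fintype κ] [DecidableEq κ]
    {A : Matrix κ κ ℂ} {w : ℂ} (hw : w ∈ spectrum ℂ (NormedSpace.exp A)) :
    ∃ z ∈ spectrum ℂ A, Complex.exp z = w := by
  rw [← spectrum_toLin', ← Module.End.hasEigenvalue_iff_mem_spectrum] at hw
  set f := (NormedSpace.exp A).toLin' with hf
  have hcomm : Commute A (NormedSpace.exp A) := by
    open scoped Matrix.Norms.Operator in exact (Commute.refl A).exp_right
  set V := Module.End.eigenspace f w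
  have hV : ∀ v ∈ V, A.toLin' v ∈ V := by
    intro v hv
    rw [Module.End.mem_eigenspace_iff] at hv ⊢
    rw [hf, toLin'_apply] at hv ⊢
    rw [toLin'_apply, mulVec_mulVec, ← hcomm.eq, ← mulVec_mulVec, hv, mulVec_smul]
  have : Nontrivial V := Submodule.nontrivial_iff_ne_bot.mpr hw
  obtain ⟨z, hz⟩ := Module.End.exists_eigenvalue (A.toLin'.restrict hV)
  obtain ⟨⟨v, hvV⟩, hv⟩ := hz.exists_hasEigenvector
  have hv1 : A *ᵥ v = z • v := by
    have := congrArg Subtype.val hv.apply_eq_smul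
    simpa using this
  have hv0 : v ≠ 0 := fun h => hv.2 (Subtype.ext h)
  refine ⟨z, ?_, ?_⟩
  · rw [← spectrum_toLin', ← Module.End.hasEigenvalue_iff_mem_spectrum]
    exact Module.End.hasEigenvalue_of_hasEigenvector
      (x := v) ⟨Module.End.mem_eigenspace_iff.mpr (by simpa using hv1), hv0⟩
  · have h1 := exp_mulVec_of_mulVec_eq_smul hv1
    have h2 : NormedSpace.exp A *ᵥ v = w • v := by
      have := Module.End.mem_eigenspace_iff.mp hvV
      simpa [hf] using this
    rw [h2] at h1
    exact (smul_left_injective ℂ hv0 h1).symm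

section
variable {κ : Type*} [Fintype κ] [DecidableEq κ]

theorem ResetControl.mem_spectrum_toC_iff {A : Matrix κ κ ℝ} {z : ℂ} :
    z ∈ spectrum ℂ (toC A) ↔ (pencil A z).det = 0 := by
  rw [spectrum.mem_iff, isUnit_iff_isUnit_det, isUnit_iff_ne_zero, not_not, pencil,
    Algebra.algebraMap_eq_smul_one]

theorem ResetControl.toC_exp (A : Matrix κ κ ℝ) :
    toC (NormedSpace.exp A) = NormedSpace.exp (toC A) := by
  open scoped Matrix.Norms.Operator in
  exact NormedSpace.map_exp (RingHom.mapMatrix (m := κ) Complex.ofRealHom)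
    (Continuous.matrix_map continuous_id Complex.continuous_ofReal) A

omit [Fintype κ] [DecidableEq κ] in
theorem ResetControl.toC_smul (t : ℝ) (A : Matrix κ κ ℝ) : toC (t • A) = (t : ℂ) • toC A := by
  ext i j; simp

theorem ResetControl.exists_det_pencil_eq_zero_of_exp {A : Matrix κ κ ℝ} {t : ℝ} (ht : t ≠ 0)
    {w : ℂ} (hw : w ∈ spectrum ℂ (toC (NormedSpace.exp (t • A)))) :
    ∃ z : ℂ, (pencil A z).det = 0 ∧ Complex.exp (t * z) = w := by
  rw [toC_exp, toC_smul] at hw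
  obtain ⟨z, hz, rfl⟩ := exists_mem_spectrum_of_mem_spectrum_exp hw
  have ht' : (t : ℂ) ≠ 0 := by exact_mod_cast ht
  refine ⟨(t : ℂ)⁻¹ * z, ?_, by rw [mul_inv_cancel_left₀ ht']⟩
  rw [← mem_spectrum_toC_iff]
  have h1 := spectrum.unit_smul_eq_smul (toC A) (Units.mk0 (t : ℂ) ht')
  rw [Units.smul_def, Units.val_mk0] at h1
  rw [h1, mem_smul_set_iff_inv_smul_mem] at hz
  simpa [Units.smul_def] using hz

theorem ResetControl.det_pencil_conj (A : Matrix κ κ ℝ) (z : ℂ) :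
    (pencil A ((starRingEnd ℂ) z)).det = (starRingEnd ℂ) (pencil A z).det := by
  rw [RingHom.map_det]
  congr 1
  ext i j
  by_cases hij : i = j <;> simp [pencil, hij]

/-- A singular `1 + exp (A π / ω)` would force an eigenvalue of `A` at an odd multiple of `jω`.
Negative multiples reduce to positive ones by conjugation, because `A` is real. -/
theorem ResetControl.isUnit_one_add_exp {A : Matrix κ κ ℝ} {ω : ℝ} (hω : 0 < ω)
    (hA : ∀ n : ℕ, Odd n → (pencil A (jw ω n)).det ≠ 0) :
    IsUnit (1 + NormedSpace.exp ((Real.pi / ω) • A)).det := by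
  have hω' : (ω : ℂ) ≠ 0 := by exact_mod_cast hω.ne'
  have hpi : (Real.pi : ℂ) ≠ 0 := by exact_mod_cast Real.pi_ne_zero
  set E := NormedSpace.exp ((Real.pi / ω) • A) with hE
  rw [isUnit_iff_ne_zero]
  intro h0
  have h1 : (-1 : ℂ) ∈ spectrum ℂ (toC E) := by
    rw [mem_spectrum_toC_iff]
    have : pencil E (-1) = -(toC (1 + E)) := by
      ext i j; by_cases hij : i = j <;> simp [pencil, hij]; ring
    rw [this, det_neg]
    have h2 : (toC (1 + E)).det = ((1 + E).det : ℂ) := (Complex.ofRealHom.map_det (1 + E)).symm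
    rw [h2, h0]; simp
  obtain ⟨z, hz, hz1⟩ := exists_det_pencil_eq_zero_of_exp (by positivity) h1
  rw [← Complex.exp_pi_mul_I, Complex.exp_eq_exp_iff_exists_int] at hz1
  obtain ⟨k, hk⟩ := hz1
  have hzk : z = Complex.I * (2 * k + 1 : ℤ) * ω := by
    push_cast at hk ⊢
    field_simp at hk
    linear_combination hk
  rcases le_or_gt 0 k with h | h
  · lift k to ℕ using h
    refine hA (2 * k + 1) ⟨k, rfl⟩ ?_
    rw [jw, ← hz, hzk]
    push_cast; rfl
  · obtain ⟨m, hm⟩ : ∃ m : ℕ, k = -(m : ℤ) - 1 := ⟨(-k - 1).toNat, by omega⟩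
    refine hA (2 * m + 1) ⟨m, rfl⟩ ?_
    have : jw ω (2 * m + 1) = (starRingEnd ℂ) z := by
      rw [hzk, jw, hm]
      simp only [map_mul, Complex.conj_I, Complex.conj_ofReal, map_intCast]
      push_cast
      ring
    rw [this, det_pencil_conj, hz, map_zero]

-- The eigenvalues of `exp (t A)` are exponentials of numbers with negative real part, so its
-- spectral radius is below one. Gelfand's formula then bounds the powers by a geometric sequence.
open scoped Matrix.Norms.Operator in
theorem ResetControl.Hurwitz.summable_exp_pow {A : Matrix κ κ ℝ} (hA : Hurwitz A) {t : ℝ}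
    (ht : 0 < t) : Summable (fun k : ℕ => NormedSpace.exp (t • A) ^ k) := by
  set E := toC (NormedSpace.exp (t • A)) with hE
  have h1 : ∀ w ∈ spectrum ℂ E, ‖w‖ < 1 := by
    intro w hw
    obtain ⟨z, hz, rfl⟩ := exists_det_pencil_eq_zero_of_exp ht.ne' hw
    rw [← mem_spectrum_toC_iff] at hz
    rw [Complex.norm_exp, Real.exp_lt_one_iff]
    have := hA z hz
    simpa using mul_neg_of_pos_of_neg ht this
  have h2 : spectralRadius ℂ E < 1 := by
    -- The strict bound on the spectral radius needs a nonempty spectrum, so dimension zero is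
    -- separate.
    rcases isEmpty_or_nonempty κ with h | h
    · have : spectrum ℂ E = ∅ := by
        rw [Subsingleton.elim E 0]; exact spectrum.of_subsingleton _
      simp [spectralRadius]
    · exact spectrum.spectralRadius_lt_of_forall_lt_of_nonempty (r := 1) (a := E)
        (spectrum.nonempty E) (fun w hw => by exact_mod_cast h1 w hw)
  obtain ⟨r, hr, hr1⟩ := ENNReal.lt_iff_exists_nnreal_btwn.mp h2
  have hr1' : r < 1 := by exact_mod_cast hr1
  have h3 : ∀ᶠ n : ℕ in Filter.atTop, ‖E ^ n‖ ≤ (r : ℝ) ^ n := by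
    have h4 := spectrum.pow_nnnorm_pow_one_div_tendsto_nhds_spectralRadius E
    filter_upwards [h4.eventually_lt_const hr, Filter.eventually_gt_atTop 0] with n hn hn0
    have h5 := ENNReal.rpow_le_rpow hn.le (Nat.cast_nonneg n : (0 : ℝ) ≤ n)
    rw [← ENNReal.rpow_mul, one_div, inv_mul_cancel₀ (by positivity), ENNReal.rpow_one,
      ENNReal.rpow_natCast] at h5
    exact_mod_cast h5
  have h6 : Summable (fun n : ℕ => E ^ n) :=
    Summable.of_norm_bounded_eventually_nat (g := fun n : ℕ => (r : ℝ) ^ n)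
      (summable_geometric_of_lt_one r.2 hr1') h3
  have h7 := h6.map ({ toFun := fun M : Matrix κ κ ℂ => M.map Complex.re,
                       map_zero' := by ext; simp
                       map_add' := fun M N => by ext; simp } : Matrix κ κ ℂ →+ Matrix κ κ ℝ)
      (Continuous.matrix_map continuous_id Complex.continuous_re)
  refine h7.congr fun n => ?_
  have h8 : E ^ n = toC (NormedSpace.exp (t • A) ^ n) :=
    (map_pow (RingHom.mapMatrix (m := κ) Complex.ofRealHom) _ n).symm
  ext i j
  simp [h8]

theorem ResetControl.Hurwitz.det_pencil_jw_ne_zero {A : Matrix κ κ ℝ} (hA : Hurwitz A) (ω : ℝ)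
    (n : ℕ) : (pencil A (jw ω n)).det ≠ 0 := by
  intro h
  have := hA _ (mem_spectrum_toC_iff.mpr h)
  simp [jw] at this

-- With `E = exp (A π / ω)` the sum is `∑ (E^(2k+2) - E^(2k+1))`. Multiplication by `1 + E` makes
-- the partial sums telescope to `E^(2n+1) - E`.
open scoped Matrix.Norms.Operator in
theorem ResetControl.Hurwitz.one_add_exp_mul_altSum {A : Matrix κ κ ℝ} (hA : Hurwitz A) {ω : ℝ}
    (hω : 0 < ω) :
    (1 + NormedSpace.exp ((Real.pi / ω) • A)) * altSum A ω =
      -NormedSpace.exp ((Real.pi / ω) • A) := by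
  set E := NormedSpace.exp ((Real.pi / ω) • A) with hE
  have hs : Summable (fun k : ℕ => E ^ k) := hA.summable_exp_pow (by positivity)
  have hpow : ∀ m : ℕ, NormedSpace.exp (((m : ℝ) * Real.pi / ω) • A) = E ^ m := by
    intro m
    rw [hE, ← Matrix.exp_nsmul, ← Nat.cast_smul_eq_nsmul ℝ, smul_smul, mul_div_assoc]
  have hterm : ∀ k : ℕ, NormedSpace.exp (((2 * k + 2 : ℝ) * Real.pi / ω) • A)
      - NormedSpace.exp (((2 * k + 1 : ℝ) * Real.pi / ω) • A) =
        E ^ (2 * k + 2) - E ^ (2 * k + 1) := by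
    intro k
    rw [← hpow, ← hpow]; push_cast; rfl
  have hs' : Summable (fun k : ℕ => E ^ (2 * k + 2) - E ^ (2 * k + 1)) :=
    (hs.comp_injective (i := fun k : ℕ => 2 * k + 2) (fun a b h => by simpa using h)).sub
      (hs.comp_injective (i := fun k : ℕ => 2 * k + 1) (fun a b h => by simpa using h))
  have h1 : Filter.Tendsto (fun n => ∑ k ∈ Finset.range n, (E ^ (2 * k + 2) - E ^ (2 * k + 1)))
      Filter.atTop (nhds (altSum A ω)) := by
    unfold altSum
    simp_rw [hterm]
    exact hs'.hasSum.tendsto_sum_nat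
  have h2 := h1.const_mul (1 + E)
  have h3 : ∀ n, (1 + E) * ∑ k ∈ Finset.range n, (E ^ (2 * k + 2) - E ^ (2 * k + 1)) =
      E ^ (2 * n + 1) - E := by
    intro n
    induction n with
    | zero => simp
    | succ n ih => 
      rw [Finset.sum_range_succ, mul_add, ih, add_mul, one_mul, mul_sub, ← pow_succ', ← pow_succ',
        show 2 * (n + 1) + 1 = 2 * n + 2 + 1 by ring]
      abel
  simp_rw [h3] at h2
  have h4 : Filter.Tendsto (fun n : ℕ => E ^ (2 * n + 1) - E) Filter.atTop (nhds (0 - E)) :=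
    ((hs.tendsto_atTop_zero).comp
      (Filter.tendsto_atTop_mono (fun n => by omega : ∀ n : ℕ, n ≤ 2 * n + 1)
        Filter.tendsto_id)).sub_const E
  rw [tendsto_nhds_unique h2 h4, zero_sub]
end

/-! ### Half-period Laplace integrals and odd harmonics. -/

namespace ResetControl

/-- The Laplace integral of `f` over the interval from `a` to `b`. -/
noncomputable def lap (a b : ℝ) (s : ℂ) (f : ℝ → ℝ) : ℂ :=
  ∫ t in a..b, (f t : ℂ) * Complex.exp (-(s * t))

section
variable {κ : Type*} [Fintype κ] [DecidableEq κ] {a b : ℝ} {s : ℂ}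

theorem intervalIntegrable_mul_exp (hab : a ≤ b) {f : ℝ → ℝ} (hf : ContinuousOn f (Icc a b)) :
    IntervalIntegrable (fun t => (f t : ℂ) * Complex.exp (-(s * t))) volume a b := by
  apply ContinuousOn.intervalIntegrable_of_Icc hab
  exact (Complex.continuous_ofReal.comp_continuousOn hf).mul (by fun_prop)

theorem lap_congr (hab : a ≤ b) {f g : ℝ → ℝ} (h : EqOn f g (Ioc a b)) :
    lap a b s f = lap a b s g := by
  refine integral_congr_ae (Filter.Eventually.of_forall fun t ht => ?_)
  rw [uIoc_of_le hab] at ht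
  rw [h ht]

theorem lap_const_mul (c : ℝ) (f : ℝ → ℝ) :
    lap a b s (fun t => c * f t) = c * lap a b s f := by
  rw [lap, lap, ← intervalIntegral.integral_const_mul]
  simp only [Complex.ofReal_mul, mul_assoc]

theorem lap_add (hab : a ≤ b) {f g : ℝ → ℝ} (hf : ContinuousOn f (Icc a b))
    (hg : ContinuousOn g (Icc a b)) :
    lap a b s (fun t => f t + g t) = lap a b s f + lap a b s g := by
  rw [lap, lap, lap, ← intervalIntegral.integral_add (intervalIntegrable_mul_exp hab hf)
    (intervalIntegrable_mul_exp hab hg)]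
  simp only [Complex.ofReal_add, add_mul]

theorem lap_sub (hab : a ≤ b) {f g : ℝ → ℝ} (hf : ContinuousOn f (Icc a b))
    (hg : ContinuousOn g (Icc a b)) :
    lap a b s (fun t => f t - g t) = lap a b s f - lap a b s g := by
  rw [lap, lap, lap, ← intervalIntegral.integral_sub (intervalIntegrable_mul_exp hab hf)
    (intervalIntegrable_mul_exp hab hg)]
  simp only [Complex.ofReal_sub, sub_mul]

omit [DecidableEq κ] in
theorem lap_dotProduct (hab : a ≤ b) (c : κ → ℝ) {x : ℝ → κ → ℝ} (hx : ContinuousOn x (Icc a b)) :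
    lap a b s (fun t => c ⬝ᵥ x t) = toCv c ⬝ᵥ fun i => lap a b s (fun t => x t i) := by
  have hx' : ∀ i, ContinuousOn (fun t => x t i) (Icc a b) := fun i =>
    (continuous_apply i).comp_continuousOn hx
  simp only [dotProduct, lap]
  rw [← funext fun i => intervalIntegral.integral_const_mul (toCv c i) _]
  rw [← intervalIntegral.integral_finsetSum fun i _ =>
    (intervalIntegrable_mul_exp hab (hx' i)).const_mul _]
  congr 1; ext t
  rw [Complex.ofReal_sum, Finset.sum_mul]
  refine Finset.sum_congr rfl fun i _ => ?_
  push_cast; ring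

/-- Integration by parts. The differential equation is required only in the open interval, so
one-sided limits may stand at the ends. -/
theorem pencil_mulVec_lap (hab : a ≤ b) {A : Matrix κ κ ℝ} {v : κ → ℝ} {x : ℝ → κ → ℝ}
    {w : ℝ → ℝ} (hx : ContinuousOn x (Icc a b)) (hw : ContinuousOn w (Icc a b))
    (hd : ∀ t ∈ Ioo a b, HasDerivAt x (A *ᵥ x t + w t • v) t) :
    (pencil A s *ᵥ fun i => lap a b s fun t => x t i) = lap a b s w • toCv v +
      (Complex.exp (-(s * a)) • toCv (x a) - Complex.exp (-(s * b)) • toCv (x b)) := by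
  ext i
  have hxi : ContinuousOn (fun t => x t i) (Icc a b) := (continuous_apply i).comp_continuousOn hx
  have hAx : ContinuousOn (fun t => A i ⬝ᵥ x t) (Icc a b) :=
    (Continuous.dotProduct continuous_const continuous_id).comp_continuousOn hx
  have hwv : ContinuousOn (fun t => v i * w t) (Icc a b) := continuousOn_const.mul hw
  have hE : ∀ t : ℝ, HasDerivAt (fun t : ℝ => Complex.exp (-(s * t)))
      (Complex.exp (-(s * t)) * -s) t := by
    intro t
    have h1 : HasDerivAt (fun t : ℝ => -(s * (t : ℂ))) (-s) t := by
      simpa using ((Complex.ofRealCLM.hasDerivAt (x := t)).const_mul s).fun_neg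
    exact h1.cexp
  have hI : IntervalIntegrable
      (fun t => ((A i ⬝ᵥ x t + v i * w t : ℝ) : ℂ) * Complex.exp (-(s * t))) volume a b :=
    intervalIntegrable_mul_exp hab (hAx.add hwv)
  have hX := (intervalIntegrable_mul_exp (s := s) hab hxi)
  have key := integral_eq_sub_of_hasDerivAt_of_le hab
    (f := fun t => (x t i : ℂ) * Complex.exp (-(s * t)))
    (f' := fun t => ((A i ⬝ᵥ x t + v i * w t : ℝ) : ℂ) * Complex.exp (-(s * t))
      - s * ((x t i : ℂ) * Complex.exp (-(s * t))))
    ((Complex.continuous_ofReal.comp_continuousOn hxi).mul (by fun_prop))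
    (fun t ht => by
      have h1 : HasDerivAt (fun t => x t i) (A i ⬝ᵥ x t + v i * w t) t := by
        have := (hasDerivAt_pi.mp (hd t ht)) i
        simpa [mulVec, mul_comm] using this
      exact (h1.ofReal_comp.fun_mul (hE t)).congr_deriv (by ring))
    (hI.sub (hX.const_mul s))
  rw [intervalIntegral.integral_sub hI (hX.const_mul s),
    intervalIntegral.integral_const_mul] at key
  have e1 : ∫ t in a..b, ((A i ⬝ᵥ x t + v i * w t : ℝ) : ℂ) * Complex.exp (-(s * t)) =
      toCv (A i) ⬝ᵥ (fun i => lap a b s (fun t => x t i)) + v i * lap a b s w := by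
    rw [← lap_dotProduct hab _ hx, ← lap_const_mul, ← lap_add hab hAx hwv]; rfl
  rw [e1] at key
  have e2 : (pencil A s *ᵥ fun i => lap a b s fun t => x t i) i =
      s * lap a b s (fun t => x t i) - toCv (A i) ⬝ᵥ (fun i => lap a b s (fun t => x t i)) := by
    rw [pencil, sub_mulVec, smul_mulVec, one_mulVec]; rfl
  rw [e2]
  simp only [Pi.add_apply, Pi.sub_apply, Pi.smul_apply, smul_eq_mul]
  unfold lap at key ⊢
  linear_combination -key

end

theorem exp_neg_jw_add {ω : ℝ} (hω : 0 < ω) {n : ℕ} (hn : Odd n) (t : ℝ) :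
    Complex.exp (-(jw ω n * ((t + Real.pi / ω : ℝ) : ℂ))) = -Complex.exp (-(jw ω n * t)) := by
  have hω' : (ω : ℂ) ≠ 0 := by exact_mod_cast hω.ne'
  obtain ⟨k, rfl⟩ := hn
  have : -(jw ω (2 * k + 1) * ((t + Real.pi / ω : ℝ) : ℂ)) = -(jw ω (2 * k + 1) * t) +
      (-(k : ℤ) - 1 : ℤ) * (2 * Real.pi * Complex.I) + Real.pi * Complex.I := by
    rw [jw]; push_cast; field_simp; ring
  rw [this, Complex.exp_add, Complex.exp_pi_mul_I, Complex.exp_add, Complex.exp_int_mul_two_pi_mul_I]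
  ring

theorem sinusoid_eq_im (P : ℂ) (ω t : ℝ) :
    sinusoid P ω t = (P * Complex.exp (Complex.I * ω * t)).im := by
  have h : P * Complex.exp (Complex.I * ω * t) =
      ‖P‖ * Complex.exp ((ω * t + P.arg : ℝ) * Complex.I) := by
    conv_lhs => rw [← Complex.norm_mul_exp_arg_mul_I P]
    rw [mul_assoc, ← Complex.exp_add]
    congr 2; push_cast; ring
  rw [h, Complex.im_ofReal_mul, Complex.exp_ofReal_mul_I_im, sinusoid]

theorem continuous_sinusoid (P : ℂ) (ω : ℝ) : Continuous (sinusoid P ω) := by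
  unfold sinusoid; fun_prop

theorem integral_exp_even {ω : ℝ} (hω : 0 < ω) (t₀ : ℝ) {m : ℤ} (hm : m ≠ 0) :
    ∫ t in t₀..(t₀ + Real.pi / ω), Complex.exp ((2 * m * Complex.I * ω) * (t : ℂ)) = 0 := by
  have hω' : (ω : ℂ) ≠ 0 := by exact_mod_cast hω.ne'
  have hm' : (m : ℂ) ≠ 0 := by exact_mod_cast hm
  rw [integral_exp_mul_complex (by simp [hω', hm'])]
  have : 2 * m * Complex.I * ω * ((t₀ + Real.pi / ω : ℝ) : ℂ) =
      2 * m * Complex.I * ω * t₀ + m * (2 * Real.pi * Complex.I) := by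
    push_cast; field_simp
  rw [this, Complex.exp_add, Complex.exp_int_mul_two_pi_mul_I]
  simp

/-- Multiplying the frequencies `±ω` by the odd kernel gives even multiples of `ω`. All of these
integrate to zero over `π/ω` except frequency zero, which occurs only for `n = 1`. -/
theorem lap_sinusoid {ω : ℝ} (hω : 0 < ω) (t₀ : ℝ) {n : ℕ} (hn : Odd n) (P : ℂ) :
    lap t₀ (t₀ + Real.pi / ω) (jw ω n) (sinusoid P ω) =
      if n = 1 then Real.pi / ω * P / (2 * Complex.I) else 0 := by
  obtain ⟨k, rfl⟩ := hn
  have h1 : ∀ t : ℝ, (sinusoid P ω t : ℂ) * Complex.exp (-(jw ω (2 * k + 1) * t)) =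
      P / (2 * Complex.I) * Complex.exp ((2 * (-(k : ℤ) : ℤ) * Complex.I * ω) * (t : ℂ)) -
      (starRingEnd ℂ) P / (2 * Complex.I) *
        Complex.exp ((2 * (-(k : ℤ) - 1 : ℤ) * Complex.I * ω) * (t : ℂ)) := by
    intro t
    have h2 : (sinusoid P ω t : ℂ) = (P * Complex.exp (Complex.I * ω * t) -
        (starRingEnd ℂ) P * Complex.exp (-(Complex.I * ω * t))) / (2 * Complex.I) := by
      rw [sinusoid_eq_im, Complex.im_eq_sub_conj, map_mul, ← Complex.exp_conj]
      simp only [map_mul, Complex.conj_I, Complex.conj_ofReal, neg_mul]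
    have h3 : (2 * (-(k : ℤ) : ℤ) * Complex.I * ω) * (t : ℂ) =
      Complex.I * ω * t + (-(jw ω (2 * k + 1) * t)) := by rw [jw]; push_cast; ring
    have h4 : (2 * (-(k : ℤ) - 1 : ℤ) * Complex.I * ω) * (t : ℂ) =
      -(Complex.I * ω * t) + (-(jw ω (2 * k + 1) * t)) := by rw [jw]; push_cast; ring
    rw [h2, h3, h4, Complex.exp_add, Complex.exp_add]
    ring
  have hint : ∀ c : ℂ, ∀ d : ℂ, IntervalIntegrable (fun t : ℝ => d * Complex.exp (c * t)) volume
      t₀ (t₀ + Real.pi / ω) := fun c d => by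
    apply Continuous.intervalIntegrable; fun_prop
  rw [lap]
  simp_rw [h1]
  rw [intervalIntegral.integral_sub (hint _ _) (hint _ _), intervalIntegral.integral_const_mul,
    intervalIntegral.integral_const_mul, integral_exp_even hω t₀ (by omega : -(k : ℤ) - 1 ≠ 0)]
  rcases Nat.eq_zero_or_pos k with rfl | hk
  · simp; ring
  · rw [integral_exp_even hω t₀ (by omega : -(k : ℤ) ≠ 0), if_neg (by omega)]
    simp

/-- A continuous function on half a period whose odd Fourier coefficients vanish is zero. -/
theorem eqOn_zero_of_lap_odd_eq_zero {ω : ℝ} (hω : 0 < ω) (t₀ : ℝ) {f : ℝ → ℝ}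
    (hf : ContinuousOn f (Icc t₀ (t₀ + Real.pi / ω)))
    (h : ∀ n, Odd n → lap t₀ (t₀ + Real.pi / ω) (jw ω n) f = 0) :
    EqOn f 0 (Icc t₀ (t₀ + Real.pi / ω)) := by
  have hω' : (ω : ℂ) ≠ 0 := by exact_mod_cast hω.ne'
  have hpi : (Real.pi : ℂ) ≠ 0 := by exact_mod_cast Real.pi_ne_zero
  have hlt : t₀ < t₀ + Real.pi / ω := by have := Real.pi_pos; simp; positivity
  have hodd : ∀ k : ℤ, ∫ t in t₀..(t₀ + Real.pi / ω),
      (f t : ℂ) * Complex.exp (-(Complex.I * (2 * k + 1) * ω * t)) = 0 := by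
    intro k
    rcases le_or_gt 0 k with hk | hk
    · lift k to ℕ using hk
      have := h (2 * k + 1) ⟨k, rfl⟩
      rw [← this, lap, jw]; push_cast; rfl
    · obtain ⟨m, hm⟩ : ∃ m : ℕ, k = -(m : ℤ) - 1 := ⟨(-k - 1).toNat, by omega⟩
      have := congrArg (starRingEnd ℂ) (h (2 * m + 1) ⟨m, rfl⟩)
      rw [map_zero, lap, ← intervalIntegral_conj] at this
      rw [← this]
      congr 1; ext t
      rw [map_mul, Complex.conj_ofReal, ← Complex.exp_conj, jw, hm]
      simp only [map_mul, map_neg, Complex.conj_I, Complex.conj_ofReal, map_natCast]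
      congr 2; push_cast; ring
  -- Modulation by `exp (-jωt)` moves the odd frequencies to the even multiples of `ω`, which are
  -- exactly the characters of a circle of length `π/ω`. Parseval then gives `‖g‖ = 0` in `L²`.
  set g : ℝ → ℂ := fun t => (f t : ℂ) * Complex.exp (-(Complex.I * ω * t)) with hg
  have hgc : ContinuousOn g (Icc t₀ (t₀ + Real.pi / ω)) :=
    (Complex.continuous_ofReal.comp_continuousOn hf).mul (by fun_prop)
  have hcoef : ∀ k : ℤ, fourierCoeffOn hlt g k = 0 := by
    intro k
    rw [fourierCoeffOn_eq_integral]
    have : ∫ x in t₀..(t₀ + Real.pi / ω), fourier (-k) (x : AddCircle (t₀ + Real.pi / ω - t₀)) • g x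
        = 0 := by
      rw [← hodd k]
      congr 1; ext t
      rw [fourier_coe_apply, hg, smul_eq_mul, mul_left_comm, ← Complex.exp_add]
      congr 2
      rw [add_sub_cancel_left]
      push_cast; field_simp; ring
    rw [this, smul_zero]
  have hmem : MemLp g 2 (volume.restrict (Ioc t₀ (t₀ + Real.pi / ω))) := by
    have h1 : MemLp g 2 (volume.restrict (Icc t₀ (t₀ + Real.pi / ω))) := by
      obtain ⟨C, hC⟩ := isCompact_Icc.exists_bound_of_continuousOn hgc
      exact MemLp.of_bound (hgc.aestronglyMeasurable measurableSet_Icc) C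
        ((ae_restrict_iff' measurableSet_Icc).mpr (Filter.Eventually.of_forall hC))
    exact h1.mono_measure (Measure.restrict_mono Ioc_subset_Icc_self le_rfl)
  have hpars := hasSum_sq_fourierCoeffOn hlt hmem
  simp only [hcoef, norm_zero, ne_eq, OfNat.ofNat_ne_zero, not_false_eq_true, zero_pow] at hpars
  have hzero := hasSum_zero.unique hpars
  have hne : (t₀ + Real.pi / ω - t₀)⁻¹ ≠ 0 := inv_ne_zero (by linarith)
  have hint : ∫ x in t₀..(t₀ + Real.pi / ω), ‖g x‖ ^ 2 = 0 :=
    (smul_eq_zero.mp hzero.symm).resolve_left hne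
  intro c hc
  by_contra hne0
  have := intervalIntegral.integral_pos hlt (hgc.norm.pow 2) (fun x _ => sq_nonneg _)
    ⟨c, hc, by
      have : g c ≠ 0 := mul_ne_zero (by exact_mod_cast hne0) (Complex.exp_ne_zero _)
      exact pow_pos (norm_pos_iff.mpr this) 2⟩
  exact this.ne' hint

/-- The hypothesis lists the odd coefficients of a sinusoid plus those of the antiperiodic response
of `(A, b, c)` to an impulse at `t₀`. By uniqueness `f` is that sum, and it is evaluated at the
right end. -/
theorem Hurwitz.eq_sinusoid_sub_altSum {κ : Type*} [Fintype κ] [DecidableEq κ]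
    {A : Matrix κ κ ℝ} (hA : Hurwitz A) (b c : κ → ℝ) {ω : ℝ} (hω : 0 < ω) (t₀ : ℝ) (P : ℂ)
    {f : ℝ → ℝ} (hf : ContinuousOn f (Icc t₀ (t₀ + Real.pi / ω)))
    (h : ∀ n, Odd n → lap t₀ (t₀ + Real.pi / ω) (jw ω n) f =
      (if n = 1 then Real.pi / ω * P / (2 * Complex.I) else 0) +
        Complex.exp (-(jw ω n * t₀)) * (toCv c ⬝ᵥ ((pencil A (jw ω n))⁻¹ *ᵥ toCv b))) :
    f (t₀ + Real.pi / ω) =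
      sinusoid P ω (t₀ + Real.pi / ω) - c ⬝ᵥ (altSum A ω *ᵥ b) := by
  have hlt : t₀ ≤ t₀ + Real.pi / ω := by have := Real.pi_pos; simp; positivity
  -- `-z₀` is the state at the end of the half period. Antiperiodicity makes the state just before
  -- the impulse `z₀`, and `(1 + E) z₀ = -E b` closes the cycle.
  set z₀ := altSum A ω *ᵥ b with hz₀
  set z : ℝ → κ → ℝ := fun t => NormedSpace.exp ((t - t₀) • A) *ᵥ (b + z₀) with hz
  have hzd : ∀ t, HasDerivAt z (A *ᵥ z t + (0 : ℝ) • (0 : κ → ℝ)) t := by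
    intro t
    have h1 : HasDerivAt (fun t : ℝ => NormedSpace.exp ((t - t₀) • A))
        (A * NormedSpace.exp ((t - t₀) • A)) t := by
      open scoped Matrix.Norms.Operator in
      have := (hasDerivAt_exp_smul_const' (𝕂 := ℝ) A (t - t₀)).comp_sub_const t t₀
      exact this
    rw [zero_smul, add_zero, hz, mulVec_mulVec, hasDerivAt_pi]
    intro i
    simp only [mulVec, dotProduct]
    refine HasDerivAt.fun_sum fun j _ => ?_
    exact ((hasDerivAt_pi.mp (hasDerivAt_pi.mp h1 i)) j).mul_const _
  have hzc : Continuous z := continuous_iff_continuousAt.mpr fun t => (hzd t).continuousAt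
  have hz1 : z t₀ = b + z₀ := by simp [hz]
  have hz2 : z (t₀ + Real.pi / ω) = -z₀ := by
    have h1 := congrArg (· *ᵥ b) (hA.one_add_exp_mul_altSum hω)
    simp only [← mulVec_mulVec, ← hz₀, add_mulVec, one_mulVec, neg_mulVec] at h1
    simp only [hz, add_sub_cancel_left, mulVec_add]
    rw [eq_neg_iff_add_eq_zero, ← sub_eq_zero.mpr h1]
    abel
  have hcz : Continuous fun t => c ⬝ᵥ z t := continuous_const.dotProduct hzc
  have hs := continuous_sinusoid P ω
  have hfs : ContinuousOn (fun t => f t - sinusoid P ω t) (Icc t₀ (t₀ + Real.pi / ω)) :=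
    hf.sub hs.continuousOn
  have hzero := eqOn_zero_of_lap_odd_eq_zero hω t₀
    (f := fun t => (f t - sinusoid P ω t) - c ⬝ᵥ z t)
    (hfs.sub hcz.continuousOn) (by
      intro n hn
      rw [lap_sub hlt hfs hcz.continuousOn, lap_sub hlt hf hs.continuousOn,
        h n hn, lap_sinusoid hω t₀ hn, lap_dotProduct hlt c hzc.continuousOn]
      have h1 := pencil_mulVec_lap (s := jw ω n) (w := fun _ => 0) (v := 0) hlt hzc.continuousOn
        continuousOn_const (fun t _ => hzd t)
      rw [hz1, hz2, exp_neg_jw_add hω hn] at h1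
      have h2 : (pencil A (jw ω n) *ᵥ fun i => lap t₀ (t₀ + Real.pi / ω) (jw ω n) fun t => z t i) =
          Complex.exp (-(jw ω n * t₀)) • toCv b := by
        rw [h1]; ext i; simp [toCv]; ring
      have hu : IsUnit (pencil A (jw ω n)).det :=
        isUnit_iff_ne_zero.mpr (hA.det_pencil_jw_ne_zero ω n)
      have h3 := congrArg ((pencil A (jw ω n))⁻¹ *ᵥ ·) h2
      simp only [mulVec_mulVec, nonsing_inv_mul _ hu, one_mulVec, mulVec_smul] at h3
      rw [h3, dotProduct_smul, smul_eq_mul]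
      ring)
  have h1 := hzero (right_mem_Icc.mpr hlt)
  simp only [hz2, dotProduct_neg, Pi.zero_apply] at h1
  linarith

/-- The phasor of an odd harmonic of a signal with half-wave symmetry, from half a period. -/
theorem harmonic_eq_lap {ω : ℝ} (hω : 0 < ω) (t₀ : ℝ) {e f : ℝ → ℝ}
    (he : ∀ t, e (t + Real.pi / ω) = -e t) (hf : ContinuousOn f (Icc t₀ (t₀ + Real.pi / ω)))
    (hef : EqOn e f (Ioc t₀ (t₀ + Real.pi / ω))) (n : ℕ) :
    harmonic e ω n = if Odd n then
      2 * Complex.I * ω / Real.pi * lap t₀ (t₀ + Real.pi / ω) (jw ω n) f else 0 := by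
  have hω' : (ω : ℂ) ≠ 0 := by exact_mod_cast hω.ne'
  have hle : t₀ ≤ t₀ + Real.pi / ω := by have := Real.pi_pos; simp; positivity
  set g : ℝ → ℂ := fun t => (e t : ℂ) * Complex.exp (-(Complex.I * n * ω * t)) with hg
  have hshift : ∀ t, g (t + Real.pi / ω) = (if Odd n then 1 else -1) * g t := by
    intro t
    split_ifs with hn
    · have := exp_neg_jw_add hω hn t
      rw [jw] at this
      simp only [hg, he, this]; push_cast; ring
    · obtain ⟨k, rfl⟩ := Nat.not_odd_iff_even.mp hn
      have : -(Complex.I * ((k + k : ℕ) : ℂ) * ω * ((t + Real.pi / ω : ℝ) : ℂ)) =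
          -(Complex.I * ((k + k : ℕ) : ℂ) * ω * t) + (-(k : ℤ) : ℤ) * (2 * Real.pi * Complex.I) := by
        push_cast; field_simp; ring
      simp only [hg, he, this, Complex.exp_add, Complex.exp_int_mul_two_pi_mul_I]
      push_cast; ring
  have hper : Function.Periodic g (2 * Real.pi / ω) := by
    intro t
    rw [show t + 2 * Real.pi / ω = t + Real.pi / ω + Real.pi / ω by ring, hshift, hshift]
    split_ifs <;> ring
  have hint : IntervalIntegrable g volume t₀ (t₀ + Real.pi / ω) := by
    refine (intervalIntegrable_mul_exp (s := jw ω n) hle hf).congr ?_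
    intro t ht
    rw [uIoc_of_le hle] at ht
    simp only [hg, hef ht, jw]
  have hint2 : IntervalIntegrable g volume (t₀ + Real.pi / ω) (t₀ + Real.pi / ω + Real.pi / ω) := by
    have h1 := (hint.comp_sub_right (Real.pi / ω)).const_mul (if Odd n then (1 : ℂ) else -1)
    refine h1.congr ?_
    intro t _
    have := hshift (t - Real.pi / ω)
    rw [sub_add_cancel] at this
    exact this.symm
  have h2 : ∫ t in (t₀ + Real.pi / ω)..(t₀ + Real.pi / ω + Real.pi / ω), g t =
      (if Odd n then 1 else -1) * ∫ t in t₀..(t₀ + Real.pi / ω), g t := by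
    rw [← intervalIntegral.integral_const_mul, ← intervalIntegral.integral_comp_add_right]
    simp only [hshift]
  have h3 : ∫ t in t₀..(t₀ + Real.pi / ω), g t = lap t₀ (t₀ + Real.pi / ω) (jw ω n) f := by
    rw [← lap_congr hle hef]; rfl
  rw [harmonic]
  change _ * ∫ t in (0 : ℝ)..(2 * Real.pi / ω), g t = _
  have h4 := hper.intervalIntegral_add_eq 0 t₀
  rw [zero_add, show t₀ + 2 * Real.pi / ω = t₀ + Real.pi / ω + Real.pi / ω by ring,
    ← intervalIntegral.integral_add_adjacent_intervals hint hint2, h2, h3] at h4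
  rw [h4]
  split_ifs <;> ring

end ResetControl

/-! ### The closed loop over one half period. -/

namespace ResetControl

variable {ι γ κ : Type*} [Fintype ι] [DecidableEq ι] [Fintype γ] [DecidableEq γ]
  [Fintype κ] [DecidableEq κ]

theorem sinusoid_add_pi_div {ω : ℝ} (hω : 0 < ω) (P : ℂ) (t : ℝ) :
    sinusoid P ω (t + Real.pi / ω) = -sinusoid P ω t := by
  rw [sinusoid, sinusoid, mul_add, mul_div_cancel₀ _ hω.ne', add_right_comm, Real.sin_add_pi]
  ring

theorem notMem_resetInstants {ω t₀ t : ℝ} (hω : 0 < ω) (ht : t ∈ Ioo t₀ (t₀ + Real.pi / ω)) :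
    t ∉ resetInstants ω t₀ := by
  rintro ⟨p, rfl⟩
  have hh : 0 < Real.pi / ω := div_pos Real.pi_pos hω
  obtain ⟨h1, h2⟩ := ht
  have h3 : (0 : ℝ) < p := by
    by_contra h; nlinarith
  have h4 : (p : ℝ) < 1 := by
    by_contra h; nlinarith
  have h5 : 0 < p := by exact_mod_cast h3
  have h6 : p < 1 := by exact_mod_cast h4
  omega

/-- For odd `n` the kernel changes sign across the interval, so the end states enter only through
their sum `d`. It is zero for a continuous antiperiodic state and is the jump for the reset element.
-/
theorem lap_state {A : Matrix κ κ ℝ} {v d : κ → ℝ} {x : ℝ → κ → ℝ} {w : ℝ → ℝ} {ω t₀ : ℝ}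
    (hω : 0 < ω) {n : ℕ} (hn : Odd n) (hA : (pencil A (jw ω n)).det ≠ 0)
    (hx : ContinuousOn x (Icc t₀ (t₀ + Real.pi / ω)))
    (hw : ContinuousOn w (Icc t₀ (t₀ + Real.pi / ω)))
    (hd : ∀ t ∈ Ioo t₀ (t₀ + Real.pi / ω), HasDerivAt x (A *ᵥ x t + w t • v) t)
    (hjump : x t₀ + x (t₀ + Real.pi / ω) = d) :
    (fun i => lap t₀ (t₀ + Real.pi / ω) (jw ω n) fun t => x t i) =
      lap t₀ (t₀ + Real.pi / ω) (jw ω n) w • ((pencil A (jw ω n))⁻¹ *ᵥ toCv v) +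
        Complex.exp (-(jw ω n * t₀)) • ((pencil A (jw ω n))⁻¹ *ᵥ toCv d) := by
  have hle : t₀ ≤ t₀ + Real.pi / ω := by have := Real.pi_pos; simp; positivity
  have h1 := pencil_mulVec_lap (s := jw ω n) hle hx hw hd
  rw [exp_neg_jw_add hω hn] at h1
  have h2 : Complex.exp (-(jw ω n * t₀)) • toCv (x t₀) - -Complex.exp (-(jw ω n * t₀)) •
      toCv (x (t₀ + Real.pi / ω)) = Complex.exp (-(jw ω n * t₀)) • toCv d := by
    rw [← hjump]; ext i; simp [toCv]; ring
  rw [h2] at h1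
  have h3 := congrArg ((pencil A (jw ω n))⁻¹ *ᵥ ·) h1
  simpa only [mulVec_mulVec, nonsing_inv_mul _ (isUnit_iff_ne_zero.mpr hA), one_mulVec, mulVec_smul,
    mulVec_add] using h3

theorem lap_output (P : SISO κ) {d : κ → ℝ} {x : ℝ → κ → ℝ} {w : ℝ → ℝ} {ω t₀ : ℝ}
    (hω : 0 < ω) {n : ℕ} (hn : Odd n) (hA : (pencil P.A (jw ω n)).det ≠ 0)
    (hx : ContinuousOn x (Icc t₀ (t₀ + Real.pi / ω)))
    (hw : ContinuousOn w (Icc t₀ (t₀ + Real.pi / ω)))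
    (hd : ∀ t ∈ Ioo t₀ (t₀ + Real.pi / ω), HasDerivAt x (P.A *ᵥ x t + w t • P.B) t)
    (hjump : x t₀ + x (t₀ + Real.pi / ω) = d) :
    lap t₀ (t₀ + Real.pi / ω) (jw ω n) (fun t => P.C ⬝ᵥ x t + P.D * w t) =
      P.tf (jw ω n) * lap t₀ (t₀ + Real.pi / ω) (jw ω n) w +
        Complex.exp (-(jw ω n * t₀)) * (toCv P.C ⬝ᵥ ((pencil P.A (jw ω n))⁻¹ *ᵥ toCv d)) := by
  have hle : t₀ ≤ t₀ + Real.pi / ω := by have := Real.pi_pos; simp; positivity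
  have hCx : ContinuousOn (fun t => P.C ⬝ᵥ x t) (Icc t₀ (t₀ + Real.pi / ω)) :=
    (continuous_const.dotProduct continuous_id).comp_continuousOn hx
  have hDw : ContinuousOn (fun t => P.D * w t) (Icc t₀ (t₀ + Real.pi / ω)) :=
    continuousOn_const.mul hw
  rw [lap_add hle hCx hDw, lap_const_mul, lap_dotProduct hle P.C hx,
    lap_state hω hn hA hx hw hd hjump, dotProduct_add, dotProduct_smul, dotProduct_smul,
    SISO.tf, smul_eq_mul, smul_eq_mul]
  ring

namespace ResetLoop

variable {S : ResetLoop ι γ κ} {ω t₀ : ℝ}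

omit [DecidableEq ι] [DecidableEq γ] [DecidableEq κ] in
-- Well-posedness solves the algebraic loop, so the signals inherit antiperiodicity and continuity
-- from the states.
theorem Trajectory.e_eq_state {r : ℝ → ℝ} {T : Set ℝ} (X : S.Trajectory r T) (hS : S.WellPosed)
    (t : ℝ) : X.e t = (1 + S.G.D * S.R.D * S.K.D)⁻¹ * (r t - S.G.C ⬝ᵥ X.xG t -
      S.G.D * (S.R.C ⬝ᵥ X.xR t + S.R.D * (S.K.C ⬝ᵥ X.xK t))) := by
  rw [eq_inv_mul_iff_mul_eq₀ hS]
  linear_combination X.e_eq t - S.G.D * X.u_eq t - S.G.D * S.R.D * X.q_eq t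

omit [DecidableEq ι] [DecidableEq γ] [DecidableEq κ] in
theorem Trajectory.e_add {r : ℝ → ℝ} {T : Set ℝ} (X : S.Trajectory r T) (hS : S.WellPosed)
    (hper : X.HalfWavePeriodic ω) (hr : ∀ t, r (t + Real.pi / ω) = -r t) (t : ℝ) :
    X.e (t + Real.pi / ω) = -X.e t := by
  obtain ⟨h1, h2, h3⟩ := hper t
  rw [X.e_eq_state hS, X.e_eq_state hS, h1, h2, h3, hr, dotProduct_neg, dotProduct_neg,
    dotProduct_neg]
  ring

omit [DecidableEq ι] [DecidableEq γ] [DecidableEq κ] in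
theorem Trajectory.continuous_xG {r : ℝ → ℝ} {T : Set ℝ} (X : S.Trajectory r T) :
    Continuous X.xG := continuous_iff_continuousAt.mpr fun t => by
  by_cases h : t ∈ T
  exacts [X.contG t h, (X.flowG t h).continuousAt]

omit [DecidableEq ι] [DecidableEq γ] [DecidableEq κ] in
theorem Trajectory.continuous_xK {r : ℝ → ℝ} {T : Set ℝ} (X : S.Trajectory r T) :
    Continuous X.xK := continuous_iff_continuousAt.mpr fun t => by
  by_cases h : t ∈ T
  exacts [X.contK t h, (X.flowK t h).continuousAt]

omit [DecidableEq ι] [DecidableEq γ] [DecidableEq κ] in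
/-- On the half period after a reset, the signals of a trajectory agree, away from the reset
instant, with signals that are continuous up to the reset instant and obey the same equations. -/
theorem Trajectory.exists_continuousOn {r : ℝ → ℝ} (X : S.Trajectory r (resetInstants ω t₀))
    (hS : S.WellPosed) (hω : 0 < ω) (hr : Continuous r) :
    ∃ (x : ℝ → ι → ℝ) (e q u : ℝ → ℝ),
      (ContinuousOn x (Icc t₀ (t₀ + Real.pi / ω)) ∧ ContinuousOn e (Icc t₀ (t₀ + Real.pi / ω)) ∧
        ContinuousOn q (Icc t₀ (t₀ + Real.pi / ω)) ∧
        ContinuousOn u (Icc t₀ (t₀ + Real.pi / ω))) ∧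
      ((∀ t, e t = r t - (S.G.C ⬝ᵥ X.xG t + S.G.D * u t)) ∧
        (∀ t, q t = S.K.C ⬝ᵥ X.xK t + S.K.D * e t) ∧
        (∀ t, u t = S.R.C ⬝ᵥ x t + S.R.D * q t)) ∧
      (∀ t ≠ t₀, x t = X.xR t ∧ e t = X.e t ∧ q t = X.q t ∧ u t = X.u t) ∧
      (∀ t ∈ Ioo t₀ (t₀ + Real.pi / ω), HasDerivAt x (S.R.A *ᵥ x t + q t • S.R.B) t) ∧
      x t₀ = S.Aρ *ᵥ X.xR t₀ := by
  classical
  have hh : 0 < Real.pi / ω := div_pos Real.pi_pos hω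
  -- The left-continuous value at `t₀` is replaced by the limit from the right, which makes `x`
  -- continuous on the closed half period.
  set x := Function.update X.xR t₀ (S.Aρ *ᵥ X.xR t₀) with hx
  have hxne : ∀ t ≠ t₀, x t = X.xR t := fun t ht => Function.update_of_ne ht _ _
  have hxc : ContinuousOn x (Icc t₀ (t₀ + Real.pi / ω)) := by
    intro t ht
    rcases eq_or_ne t t₀ with rfl | hne
    · rw [hx, continuousWithinAt_update_same]
      refine (X.jump t ⟨0, by simp⟩).mono_left (nhdsWithin_mono _ ?_)
      rintro y ⟨hy, hy'⟩
      exact lt_of_le_of_ne hy.1 (Ne.symm hy')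
    · rw [hx, continuousWithinAt_update_of_ne hne]
      rcases ht.2.eq_or_lt with h1 | h1
      · exact (X.leftR t ⟨1, by rw [h1]; simp⟩).mono fun y hy => h1 ▸ hy.2
      · exact (X.flowR t (notMem_resetInstants hω
          ⟨lt_of_le_of_ne ht.1 hne.symm, h1⟩)).continuousAt.continuousWithinAt
  set e : ℝ → ℝ := fun t => (1 + S.G.D * S.R.D * S.K.D)⁻¹ * (r t - S.G.C ⬝ᵥ X.xG t -
      S.G.D * (S.R.C ⬝ᵥ x t + S.R.D * (S.K.C ⬝ᵥ X.xK t))) with he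
  set q : ℝ → ℝ := fun t => S.K.C ⬝ᵥ X.xK t + S.K.D * e t with hq
  set u : ℝ → ℝ := fun t => S.R.C ⬝ᵥ x t + S.R.D * q t with hu
  have hG : Continuous fun t => S.G.C ⬝ᵥ X.xG t := continuous_const.dotProduct X.continuous_xG
  have hK : Continuous fun t => S.K.C ⬝ᵥ X.xK t := continuous_const.dotProduct X.continuous_xK
  have hR : ContinuousOn (fun t => S.R.C ⬝ᵥ x t) (Icc t₀ (t₀ + Real.pi / ω)) :=
    (continuous_const.dotProduct continuous_id).comp_continuousOn hxc
  have hec : ContinuousOn e (Icc t₀ (t₀ + Real.pi / ω)) :=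
    continuousOn_const.mul ((hr.sub hG).continuousOn.sub
      (continuousOn_const.mul (hR.add (continuousOn_const.mul hK.continuousOn))))
  have hqc : ContinuousOn q (Icc t₀ (t₀ + Real.pi / ω)) :=
    hK.continuousOn.add (continuousOn_const.mul hec)
  have hene : ∀ t ≠ t₀, e t = X.e t := fun t ht => by
    rw [X.e_eq_state hS, he]
    simp only [hxne t ht]
  have hqne : ∀ t ≠ t₀, q t = X.q t := fun t ht => by rw [X.q_eq, hq]; simp only [hene t ht]
  refine ⟨x, e, q, u, ⟨hxc, hec, hqc, hR.add (continuousOn_const.mul hqc)⟩,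
    ⟨fun t => ?_, fun t => rfl, fun t => rfl⟩,
    fun t ht => ⟨hxne t ht, hene t ht, hqne t ht, ?_⟩, fun t ht => ?_,
    Function.update_self _ _ _⟩
  · have h1 : (1 + S.G.D * S.R.D * S.K.D) * e t = r t - S.G.C ⬝ᵥ X.xG t -
        S.G.D * (S.R.C ⬝ᵥ x t + S.R.D * (S.K.C ⬝ᵥ X.xK t)) := mul_inv_cancel_left₀ hS _
    simp only [hu, hq]
    linear_combination h1
  · rw [X.u_eq, hu]; simp only [hxne t ht, hqne t ht]
  · rw [hxne t ht.1.ne', hqne t ht.1.ne']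
    refine (X.flowR t (notMem_resetInstants hω ht)).congr_of_eventuallyEq ?_
    filter_upwards [isOpen_ne.mem_nhds ht.1.ne'] with y hy using hxne y hy

/-- The loop equations in the frequency domain, for a half-wave periodic response. -/
theorem Trajectory.exists_lap {r : ℝ → ℝ} (X : S.Trajectory r (resetInstants ω t₀))
    (hS : S.WellPosed) (hω : 0 < ω) (hr : Continuous r) (hper : X.HalfWavePeriodic ω) :
    ∃ (x : ℝ → ι → ℝ) (e q : ℝ → ℝ),
      (ContinuousOn x (Icc t₀ (t₀ + Real.pi / ω)) ∧ ContinuousOn e (Icc t₀ (t₀ + Real.pi / ω)) ∧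
        ContinuousOn q (Icc t₀ (t₀ + Real.pi / ω))) ∧
      (∀ t ≠ t₀, x t = X.xR t ∧ e t = X.e t ∧ q t = X.q t) ∧
      ∀ n, Odd n → S.Regular (jw ω n) →
        lap t₀ (t₀ + Real.pi / ω) (jw ω n) e = S.SL (jw ω n) *
          (lap t₀ (t₀ + Real.pi / ω) (jw ω n) r - S.G.tf (jw ω n) *
            (Complex.exp (-(jw ω n * t₀)) * (S.Rδ (jw ω n) ⬝ᵥ toCv (X.xR t₀)))) ∧
        lap t₀ (t₀ + Real.pi / ω) (jw ω n) q =
          S.K.tf (jw ω n) * lap t₀ (t₀ + Real.pi / ω) (jw ω n) e ∧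
        ∀ i, lap t₀ (t₀ + Real.pi / ω) (jw ω n) (fun t => x t i) =
          lap t₀ (t₀ + Real.pi / ω) (jw ω n) q * S.RXL (jw ω n) i +
            Complex.exp (-(jw ω n * t₀)) * (S.RXδ (jw ω n) *ᵥ toCv (X.xR t₀)) i := by
  obtain ⟨x, e, q, u, ⟨hxc, hec, hqc, huc⟩, ⟨he, hq, hu⟩, hne, hd, hx0⟩ :=
    X.exists_continuousOn hS hω hr
  have hh : 0 < Real.pi / ω := div_pos Real.pi_pos hω
  have hle : t₀ ≤ t₀ + Real.pi / ω := by linarith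
  refine ⟨x, e, q, ⟨hxc, hec, hqc⟩, fun t ht => ⟨(hne t ht).1, (hne t ht).2.1, (hne t ht).2.2.1⟩,
    fun n hn hreg => ?_⟩
  obtain ⟨hRA, hGA, hKA, hL⟩ := hreg
  obtain ⟨hp1, hp2, hp3⟩ := hper t₀
  have hne' : ∀ t ∈ Ioo t₀ (t₀ + Real.pi / ω), t ≠ t₀ := fun t ht => ht.1.ne'
  -- The left end carries `Aρ x`, the right end the state before the next reset, which is `-x` by
  -- symmetry.
  have hjump : x t₀ + x (t₀ + Real.pi / ω) = (S.Aρ - 1) *ᵥ X.xR t₀ := by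
    rw [hx0, (hne (t₀ + Real.pi / ω) (by linarith)).1, hp1, sub_mulVec, one_mulVec, sub_eq_add_neg]
  have htoC : toCv ((S.Aρ - 1) *ᵥ X.xR t₀) = toC (S.Aρ - 1) *ᵥ toCv (X.xR t₀) := by
    ext i; exact RingHom.map_mulVec Complex.ofRealHom _ _ i
  have hR := lap_output S.R hω hn hRA hxc hqc hd hjump
  have hX := lap_state hω hn hRA hxc hqc hd hjump
  have hG := lap_output S.G (d := 0) hω hn hGA X.continuous_xG.continuousOn huc
    (fun t ht => (hne t (hne' t ht)).2.2.2 ▸ X.flowG t (notMem_resetInstants hω ht))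
    (by rw [hp2, add_neg_cancel])
  have hK := lap_output S.K (d := 0) hω hn hKA X.continuous_xK.continuousOn hec
    (fun t ht => (hne t (hne' t ht)).2.1 ▸ X.flowK t (notMem_resetInstants hω ht))
    (by rw [hp3, add_neg_cancel])
  have hz : toCv (0 : γ → ℝ) = 0 := by ext; simp [toCv]
  have hz' : toCv (0 : κ → ℝ) = 0 := by ext; simp [toCv]
  rw [hz, mulVec_zero, dotProduct_zero, mul_zero, add_zero] at hG
  rw [hz', mulVec_zero, dotProduct_zero, mul_zero, add_zero] at hK
  rw [← funext hq] at hK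
  rw [← funext hu, htoC, mulVec_mulVec] at hR
  rw [htoC, mulVec_mulVec] at hX
  have hGc : ContinuousOn (fun t => S.G.C ⬝ᵥ X.xG t + S.G.D * u t) (Icc t₀ (t₀ + Real.pi / ω)) :=
    (continuous_const.dotProduct X.continuous_xG).continuousOn.add (continuousOn_const.mul huc)
  have hE := lap_sub (s := jw ω n) hle hr.continuousOn hGc
  rw [← funext he, hG] at hE
  have hδ : S.Rδ (jw ω n) ⬝ᵥ toCv (X.xR t₀) =
      toCv S.R.C ⬝ᵥ (((pencil S.R.A (jw ω n))⁻¹ * toC (S.Aρ - 1)) *ᵥ toCv (X.xR t₀)) := by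
    rw [Rδ, RXδ, dotProduct_mulVec]
  refine ⟨?_, hK, fun i => ?_⟩
  · rw [SL, eq_inv_mul_iff_mul_eq₀ hL, hδ]
    -- Eliminates the transforms of `u` and `q` from the loop.
    linear_combination hE - S.G.tf (jw ω n) * hR - S.G.tf (jw ω n) * S.R.tf (jw ω n) * hK
  · have := congrFun hX i
    simpa [RXL, RXδ] using this

section
variable {ν μ : Type*} [Fintype ν] [DecidableEq ν] [Fintype μ] [DecidableEq μ]
  {RI : ℂ} (X : S.Trajectory (sinusoid RI ω) (resetInstants ω t₀))

/-- The odd coefficients of `q` are those of the base linear response minus the response of `Q_δ` to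
the reset impulse. The equation expresses that `q` vanishes just before a reset. -/
theorem Trajectory.sinusoid_qL_eq (hS : S.WellPosed) (hω : 0 < ω)
    (hreg : ∀ k : ℕ, Odd k → S.Regular (jw ω k)) (hper : X.HalfWavePeriodic ω)
    {AQ : Matrix ν ν ℝ} {BQ : Matrix ν ι ℝ} {CQ : ν → ℝ}
    (hQ : S.RealizesQ AQ BQ CQ) (hAQ : Hurwitz AQ) :
    sinusoid (S.qL ω RI) ω t₀ = CQ ⬝ᵥ ((altSum AQ ω * BQ) *ᵥ X.xR t₀) := by
  have hh : 0 < Real.pi / ω := div_pos Real.pi_pos hω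
  obtain ⟨x, e, q, ⟨hxc, hec, hqc⟩, hne, hlap⟩ :=
    X.exists_lap hS hω (continuous_sinusoid RI ω) hper
  have h1 := hAQ.eq_sinusoid_sub_altSum (-(BQ *ᵥ X.xR t₀)) CQ hω t₀ (S.qL ω RI) hqc (by
    intro n hn
    obtain ⟨hE, hq, -⟩ := hlap n hn (hreg n hn)
    have hb : toCv CQ ⬝ᵥ ((pencil AQ (jw ω n))⁻¹ *ᵥ toCv (-(BQ *ᵥ X.xR t₀))) =
        -((S.K.tf (jw ω n) * S.SL (jw ω n) * S.G.tf (jw ω n)) *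
          (S.Rδ (jw ω n) ⬝ᵥ toCv (X.xR t₀))) := by
      have h2 : toCv (-(BQ *ᵥ X.xR t₀)) = -(toC BQ *ᵥ toCv (X.xR t₀)) := by
        ext i
        exact (Complex.ofReal_neg _).trans
          (congrArg Neg.neg (RingHom.map_mulVec Complex.ofRealHom _ _ i))
      rw [h2, mulVec_neg, dotProduct_neg, mulVec_mulVec, dotProduct_mulVec,
        hQ _ (hreg n hn) (hAQ.det_pencil_jw_ne_zero ω n), smul_dotProduct, smul_eq_mul]
    rw [hq, hE, hb, lap_sinusoid hω t₀ hn]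
    split_ifs with h
    · subst h; rw [qL]; ring
    · ring)
  -- The right end is used because it carries the value before a reset. At `t₀` the extended `q`
  -- carries the value after it, which need not vanish when there is feed-through.
  rw [(hne (t₀ + Real.pi / ω) (by linarith)).2.2, X.zero _ ⟨1, by simp⟩, sinusoid_add_pi_div hω,
    mulVec_neg, dotProduct_neg, mulVec_mulVec] at h1
  linarith

/-- The same argument for each component of the reset state, with `H` in place of `-Q_δ`. Both sides
change sign when the right end is brought back to `t₀`. -/
theorem Trajectory.xR_eq (hS : S.WellPosed) (hω : 0 < ω)
    (hreg : ∀ k : ℕ, Odd k → S.Regular (jw ω k)) (hper : X.HalfWavePeriodic ω)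
    {AH : Matrix μ μ ℝ} {BH : Matrix μ ι ℝ} {CH : Matrix ι μ ℝ}
    (hH : S.RealizesH AH BH CH) (hAH : Hurwitz AH) (i : ι) :
    X.xR t₀ i = sinusoid (S.qL ω RI * S.RXL (jw ω 1) i) ω t₀ +
      ((CH * altSum AH ω * BH) *ᵥ X.xR t₀) i := by
  have hh : 0 < Real.pi / ω := div_pos Real.pi_pos hω
  obtain ⟨x, e, q, ⟨hxc, hec, hqc⟩, hne, hlap⟩ :=
    X.exists_lap hS hω (continuous_sinusoid RI ω) hper
  have h1 := hAH.eq_sinusoid_sub_altSum (BH *ᵥ X.xR t₀) (CH i) hω t₀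
    (S.qL ω RI * S.RXL (jw ω 1) i) ((continuous_apply i).comp_continuousOn hxc) (by
    intro n hn
    obtain ⟨hE, hq, hx⟩ := hlap n hn (hreg n hn)
    have hb : toCv (CH i) ⬝ᵥ ((pencil AH (jw ω n))⁻¹ *ᵥ toCv (BH *ᵥ X.xR t₀)) =
        (S.RXδ (jw ω n) *ᵥ toCv (X.xR t₀)) i -
        (S.K.tf (jw ω n) * S.SL (jw ω n) * S.G.tf (jw ω n)) *
          (S.RXL (jw ω n) i * (S.Rδ (jw ω n) ⬝ᵥ toCv (X.xR t₀))) := by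
      have h2 : toCv (BH *ᵥ X.xR t₀) = toC BH *ᵥ toCv (X.xR t₀) := by
        ext i; exact RingHom.map_mulVec Complex.ofRealHom _ _ i
      have h3 := congrFun (congrArg (· *ᵥ toCv (X.xR t₀))
        (hH _ (hreg n hn) (hAH.det_pencil_jw_ne_zero ω n))) i
      simp only [sub_mulVec, smul_mulVec, vecMulVec_mulVec, Pi.sub_apply, Pi.smul_apply,
        smul_eq_mul, MulOpposite.smul_eq_mul_unop, MulOpposite.unop_op, ← mulVec_mulVec] at h3
      rw [h2, ← h3]
      rfl
    have := hx i
    change lap t₀ (t₀ + Real.pi / ω) (jw ω n) (fun t => x t i) = _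
    rw [this, hq, hE, hb, lap_sinusoid hω t₀ hn]
    split_ifs with h
    · subst h; rw [qL]; ring
    · ring)
  rw [Function.comp_apply, (hne (t₀ + Real.pi / ω) (by linarith)).1, (hper t₀).1,
    sinusoid_add_pi_div hω, Pi.neg_apply] at h1
  have h4 : CH i ⬝ᵥ altSum AH ω *ᵥ BH *ᵥ X.xR t₀ =
      ((CH * altSum AH ω * BH) *ᵥ X.xR t₀) i := by
    rw [← mulVec_mulVec, ← mulVec_mulVec]; rfl
  rw [h4] at h1
  linarith

end

end ResetLoop
end ResetControl

/-! ### Phase estimates and describing-function algebra. -/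

namespace ResetControl

theorem mul_exp_eq_norm_mul_exp (P : ℂ) (ω t : ℝ) : P * Complex.exp (Complex.I * ω * t) =
    ‖P‖ * Complex.exp ((ω * t + P.arg : ℝ) * Complex.I) := by
  conv_lhs => rw [← Complex.norm_mul_exp_arg_mul_I P]
  rw [mul_assoc, ← Complex.exp_add]
  congr 2; push_cast; ring

theorem deriv_sinusoid (P : ℂ) (ω t : ℝ) :
    deriv (sinusoid P ω) t = ‖P‖ * (Real.cos (ω * t + P.arg) * ω) := by
  have h1 : HasDerivAt (fun t => ω * t + P.arg) ω t := by
    simpa using ((hasDerivAt_id t).const_mul ω).add_const P.arg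
  exact (h1.sin.const_mul ‖P‖).deriv

theorem cos_arcsin_sin_of_cos_neg {θ : ℝ} (h : Real.cos θ < 0) :
    Real.cos (Real.arcsin (Real.sin θ)) = -Real.cos θ := by
  rw [Real.cos_arcsin, ← Real.abs_cos_eq_sqrt_one_sub_sin_sq, abs_of_neg h]

/-- With `y = arcsin (tan φ)` and `δ = y - φ`, the relation `sin y cos φ = sin φ` gives `sin δ = sin
φ (1 - cos y)`. Since `1 - cos y ≤ sin² y = tan² φ`, it follows that `sin δ cos² φ ≤ φ³`. -/
theorem arcsin_tan_sub_le {φ : ℝ} (h0 : 0 ≤ φ) (h1 : φ ≤ Real.pi / 4) :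
    0 ≤ Real.arcsin (Real.tan φ) - φ ∧
      Real.cos φ * (Real.arcsin (Real.tan φ) - φ) ≤ 2 * φ ^ 3 := by
  have hpi := Real.pi_pos
  have hpi2 := Real.pi_lt_d2
  set y := Real.arcsin (Real.tan φ) with hy
  have htan0 : 0 ≤ Real.tan φ := Real.tan_nonneg_of_nonneg_of_le_pi_div_two h0 (by linarith)
  have htan1 : Real.tan φ ≤ 1 := by
    rcases h1.eq_or_lt with h | h
    · rw [h, Real.tan_pi_div_four]
    · rw [← Real.tan_pi_div_four]
      exact (Real.tan_lt_tan_of_lt_of_lt_pi_div_two (by linarith) (by linarith) h).le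
  have hcos : 7 / 10 ≤ Real.cos φ := by
    have h2 : Real.cos (Real.pi / 4) ≤ Real.cos φ :=
      Real.cos_le_cos_of_nonneg_of_le_pi h0 (by linarith) h1
    rw [Real.cos_pi_div_four] at h2
    have h3 : (7 / 5 : ℝ) ≤ √2 := Real.le_sqrt_of_sq_le (by norm_num)
    linarith
  have hcos1 := Real.cos_le_one φ
  have hsinle : Real.sin φ ≤ φ := Real.sin_le h0
  have hsin0 : 0 ≤ Real.sin φ := Real.sin_nonneg_of_nonneg_of_le_pi h0 (by linarith)
  have htc : Real.tan φ * Real.cos φ = Real.sin φ := Real.tan_mul_cos (by linarith)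
  have hsy : Real.sin y = Real.tan φ := Real.sin_arcsin (by linarith) htan1
  have hφy : φ ≤ y := by
    rw [← Real.arcsin_sin (by linarith : -(Real.pi / 2) ≤ φ) (by linarith)]
    exact Real.monotone_arcsin (by nlinarith)
  have hy2 : y ≤ Real.pi / 2 := Real.arcsin_le_pi_div_two _
  have hcy0 : 0 ≤ Real.cos y := Real.cos_nonneg_of_neg_pi_div_two_le_of_le (by linarith) hy2
  have hcy1 := Real.cos_le_one y
  set δ := y - φ with hδ
  have hδ0 : 0 ≤ δ := by linarith
  have hsδ : Real.sin δ = Real.sin φ * (1 - Real.cos y) := by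
    rw [hδ, Real.sin_sub, hsy, htc]; ring
  have hδφ : δ ≤ φ := by
    rw [← Real.arcsin_sin (by linarith : -(Real.pi / 2) ≤ δ) (by linarith),
      ← Real.arcsin_sin (by linarith : -(Real.pi / 2) ≤ φ) (by linarith)]
    exact Real.monotone_arcsin (by rw [hsδ]; nlinarith)
  refine ⟨hδ0, ?_⟩
  have h4 : 1 - Real.cos y ≤ Real.tan φ ^ 2 := by
    rw [← hsy]; nlinarith [Real.sin_sq_add_cos_sq y]
  have h5 : Real.sin δ * Real.cos φ ^ 2 ≤ φ ^ 3 := by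
    calc Real.sin δ * Real.cos φ ^ 2 ≤ Real.sin φ * Real.tan φ ^ 2 * Real.cos φ ^ 2 := by
          rw [hsδ]; gcongr
      _ = Real.sin φ ^ 3 := by rw [mul_assoc, ← mul_pow, htc]; ring
      _ ≤ φ ^ 3 := by gcongr
  -- From `δ ≤ φ ≤ π/4` one has `δ² ≤ 0.64`, and the cubic lower bound for the sine gives 0.84.
  -- Together with `cos φ ≥ 0.7` the final constant is `1 / (0.84 · 0.7) < 2`.
  have h6 : 84 / 100 * δ ≤ Real.sin δ := by
    rcases hδ0.eq_or_lt with h | h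
    · rw [← h]; simp
    · have h7 := Real.sin_gt_sub_cube h
      have h8 : δ ^ 2 ≤ 64 / 100 := by nlinarith
      nlinarith
  have h9 : 0 ≤ Real.cos φ * δ := mul_nonneg (by linarith) hδ0
  have h10 : 84 / 100 * δ * Real.cos φ ^ 2 ≤ φ ^ 3 :=
    (mul_le_mul_of_nonneg_right h6 (sq_nonneg _)).trans h5
  have h11 : 7 / 10 * (Real.cos φ * δ) ≤ Real.cos φ * (Real.cos φ * δ) :=
    mul_le_mul_of_nonneg_right hcos h9
  have h12 : 0 ≤ φ ^ 3 := by positivity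
  linarith

theorem cos_mul_abs_arcsin_tan_sub_le {φ : ℝ} (h : |φ| ≤ Real.pi / 4) :
    Real.cos φ * |Real.arcsin (Real.tan φ) - φ| ≤ 2 * |φ| ^ 3 := by
  have h1 := arcsin_tan_sub_le (abs_nonneg φ) h
  rcases abs_cases φ with ⟨h2, -⟩ | ⟨h2, -⟩
  · rw [h2] at h1 ⊢
    rw [abs_of_nonneg h1.1]; exact h1.2
  · rw [h2, Real.tan_neg, Real.arcsin_neg, Real.cos_neg] at h1
    rw [h2, ← abs_neg, neg_sub', abs_of_nonneg h1.1]; exact h1.2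

variable {ι γ κ ν μ : Type*} [Fintype ι] [DecidableEq ι] [Fintype γ] [DecidableEq γ]
  [Fintype κ] [DecidableEq κ] [Fintype ν] [DecidableEq ν] [Fintype μ] [DecidableEq μ]

namespace ResetLoop

variable {S : ResetLoop ι γ κ} {ω : ℝ}

-- `Λ = (jωI - A_R)(-jωI - A_R)`, and the second factor is the conjugate of the first.
omit [Fintype γ] [DecidableEq γ] [Fintype κ] [DecidableEq κ] in
theorem isUnit_Λ (h : (pencil S.R.A (jw ω 1)).det ≠ 0) : IsUnit (S.Λ ω).det := by
  have h1 : toC (S.Λ ω) = pencil S.R.A (jw ω 1) * pencil S.R.A ((starRingEnd ℂ) (jw ω 1)) := by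
    have h2 : toC (S.Λ ω) = ((ω : ℂ) ^ 2) • 1 + toC S.R.A * toC S.R.A := by
      have h3 : toC (S.R.A * S.R.A) = toC S.R.A * toC S.R.A :=
        map_mul (RingHom.mapMatrix (m := ι) Complex.ofRealHom) _ _
      rw [← h3]
      ext i j
      by_cases hij : i = j <;> simp [Λ, hij, sq]
    have h4 : (starRingEnd ℂ) (jw ω 1) = -jw ω 1 := by simp [jw]
    have h5 : (ω : ℂ) ^ 2 = -(jw ω 1 * jw ω 1) := by
      simp only [jw]; push_cast; linear_combination ((ω : ℂ) ^ 2) * Complex.I_mul_I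
    rw [h2, h4, h5, pencil, pencil, sub_mul, mul_sub, mul_sub]
    simp only [smul_mul_assoc, mul_smul_comm, one_mul, mul_one, smul_smul]
    module
  have h6 : ((S.Λ ω).det : ℂ) ≠ 0 := by
    have h7 : (toC (S.Λ ω)).det = ((S.Λ ω).det : ℂ) :=
      (Complex.ofRealHom.map_det (S.Λ ω)).symm
    rw [← h7, h1, det_mul, det_pencil_conj]
    exact mul_ne_zero h ((map_ne_zero _).mpr h)
  exact isUnit_iff_ne_zero.mpr (by exact_mod_cast h6)

-- From `(jωI - A_R)(jωI + A_R) = -Λ`. This splits the resolvent into real and imaginary parts,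
-- which become the sine and cosine terms of the reset state.
omit [Fintype γ] [DecidableEq γ] [Fintype κ] [DecidableEq κ] in
theorem RXL_jw_one (h : (pencil S.R.A (jw ω 1)).det ≠ 0) (i : ι) :
    S.RXL (jw ω 1) i = -((((S.R.A *ᵥ ((S.Λ ω)⁻¹ *ᵥ S.R.B)) i : ℝ) : ℂ) +
      Complex.I * ω * (((S.Λ ω)⁻¹ *ᵥ S.R.B) i : ℝ)) := by
  set w := (S.Λ ω)⁻¹ *ᵥ S.R.B with hw
  have hΛ : S.Λ ω *ᵥ w = S.R.B := by
    rw [hw, mulVec_mulVec, mul_nonsing_inv _ (isUnit_Λ h), one_mulVec]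
  have hB : S.R.B = ω ^ 2 • w + S.R.A *ᵥ (S.R.A *ᵥ w) := by
    rw [mulVec_mulVec, ← sq]; conv_lhs => rw [← hΛ, Λ, add_mulVec, smul_mulVec, one_mulVec]
  have h1 : pencil S.R.A (jw ω 1) *ᵥ (-(toCv (S.R.A *ᵥ w) + (Complex.I * ω) • toCv w)) =
      toCv S.R.B := by
    have h2 : ∀ v : ι → ℝ, toC S.R.A *ᵥ toCv v = toCv (S.R.A *ᵥ v) := fun v => by
      ext i; exact (RingHom.map_mulVec Complex.ofRealHom _ _ i).symm
    rw [pencil, sub_mulVec, smul_mulVec, one_mulVec, mulVec_neg, mulVec_add, mulVec_smul, h2, h2]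
    ext i
    rw [hB]
    simp only [toCv, jw, Pi.add_apply, Pi.sub_apply, Pi.neg_apply, Pi.smul_apply, smul_eq_mul]
    push_cast
    linear_combination (-(ω : ℂ) ^ 2 * (w i : ℂ)) * Complex.I_mul_I
  have h3 := congrArg ((pencil S.R.A (jw ω 1))⁻¹ *ᵥ ·) h1
  simp only [mulVec_mulVec, nonsing_inv_mul _ (isUnit_iff_ne_zero.mpr h), one_mulVec] at h3
  rw [RXL, ← h3]
  rfl

omit [Fintype γ] [DecidableEq γ] [Fintype κ] [DecidableEq κ] in
theorem sinusoid_mul_RXL (h : (pencil S.R.A (jw ω 1)).det ≠ 0) (P : ℂ) (t : ℝ) (i : ι) :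
    sinusoid (P * S.RXL (jw ω 1) i) ω t = -(‖P‖ * Real.sin (ω * t + P.arg) *
      (S.R.A *ᵥ ((S.Λ ω)⁻¹ *ᵥ S.R.B)) i + ‖P‖ * Real.cos (ω * t + P.arg) * ω *
      ((S.Λ ω)⁻¹ *ᵥ S.R.B) i) := by
  rw [sinusoid_eq_im, mul_right_comm, mul_exp_eq_norm_mul_exp, RXL_jw_one h, Complex.exp_mul_I,
    ← Complex.ofReal_cos, ← Complex.ofReal_sin]
  generalize Real.sin (ω * t + P.arg) = y
  generalize Real.cos (ω * t + P.arg) = z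
  generalize (S.R.A *ᵥ ((S.Λ ω)⁻¹ *ᵥ S.R.B)) i = v
  generalize ((S.Λ ω)⁻¹ *ᵥ S.R.B) i = w
  simp
  ring

omit [Fintype γ] [DecidableEq γ] [Fintype κ] [DecidableEq κ] in
theorem commute_A_Λ : Commute S.R.A (S.Λ ω) := by
  rw [Λ]
  exact ((Commute.one_right _).smul_right _).add_right ((Commute.refl _).pow_right 2)

omit [Fintype γ] [DecidableEq γ] [Fintype κ] [DecidableEq κ] in
theorem commute_A_Δ : Commute S.R.A (S.Δ ω) := by
  rw [Δ, expR]
  open scoped Matrix.Norms.Operator in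
  exact (Commute.one_right _).add_right (((Commute.refl _).smul_right _).exp_right)

omit [Fintype γ] [DecidableEq γ] [Fintype κ] [DecidableEq κ] in
theorem commute_Λ_Δ : Commute (S.Λ ω) (S.Δ ω) := by
  rw [Λ]
  exact ((Commute.one_left _).smul_left _).add_left (commute_A_Δ.pow_left 2)

omit [Fintype γ] [DecidableEq γ] [Fintype κ] [DecidableEq κ] in
theorem A_mulVec_Λ_inv (h : IsUnit (S.Λ ω).det) (v : ι → ℝ) :
    S.R.A *ᵥ ((S.Λ ω)⁻¹ *ᵥ v) = ((S.Λ ω)⁻¹ * S.R.A) *ᵥ v := by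
  rw [mulVec_mulVec]
  congr 1
  calc S.R.A * (S.Λ ω)⁻¹ = (S.Λ ω)⁻¹ * (S.Λ ω * S.R.A) * (S.Λ ω)⁻¹ := by
        rw [← Matrix.mul_assoc, nonsing_inv_mul _ h, Matrix.one_mul]
    _ = _ := by
        rw [← commute_A_Λ.eq, ← Matrix.mul_assoc, Matrix.mul_assoc, mul_nonsing_inv _ h,
          Matrix.mul_one]

/-- The describing function with virtual input vector `B⋆` sees precisely the reset jump. Writing `E
= exp (A_R π / ω)`, the identity `Aρ (1 + E Aρ) = (1 + Aρ E) Aρ` cancels `Δ_D`, and then `Δ Aρ - (1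
+ E Aρ) = Aρ - 1`. -/
theorem norm_smul_Θ_mulVec_Bstar (hω : 0 < ω) {RI : ℂ} (hΛ : IsUnit (S.Λ ω).det)
    (hΔ : IsUnit (S.Δ ω).det) (hD : IsUnit (S.ΔD ω).det) (hκ : ‖S.qL ω RI‖ ≠ 0) (x : ι → ℝ) :
    ‖S.qL ω RI‖ • (S.Θ ω *ᵥ S.Bstar ω RI x) = (-(2 * ω / Real.pi)) • ((S.Aρ - 1) *ᵥ x) := by
  set Z := 1 + S.expR ω * S.Aρ with hZ
  set Y := (S.Δ ω)⁻¹ * S.Λ ω * Z with hY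
  have h1 : (S.Λ ω)⁻¹ * Y = (S.Δ ω)⁻¹ * Z := by
    have h2 : (S.Λ ω)⁻¹ * (S.Δ ω)⁻¹ = (S.Δ ω)⁻¹ * (S.Λ ω)⁻¹ := by
      rw [← Matrix.mul_inv_rev, ← Matrix.mul_inv_rev, commute_Λ_Δ.eq]
    rw [hY, ← Matrix.mul_assoc, ← Matrix.mul_assoc, h2, Matrix.mul_assoc (S.Δ ω)⁻¹,
      nonsing_inv_mul _ hΛ, Matrix.mul_one]
  have h3 : S.Δ ω * ((S.Δ ω)⁻¹ * Z) = Z := by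
    rw [← Matrix.mul_assoc, mul_nonsing_inv _ hΔ, Matrix.one_mul]
  have h4 : S.Γ ω * Y = S.Aρ := by
    have h5 : S.Aρ * Z = S.ΔD ω * S.Aρ := by rw [hZ, ΔD]; noncomm_ring
    rw [Γ, Matrix.mul_assoc, h1, Matrix.mul_assoc, h3, Matrix.mul_assoc, h5, ← Matrix.mul_assoc,
      nonsing_inv_mul _ hD, Matrix.one_mul]
  have h6 : S.Δ ω * (S.Γ ω - (S.Λ ω)⁻¹) * Y = S.Aρ - 1 := by
    rw [Matrix.mul_assoc, Matrix.sub_mul, h4, h1, Matrix.mul_sub, h3, hZ, Δ]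
    noncomm_ring
  rw [Bstar, ← hY, Θ, mulVec_smul, smul_mulVec, mulVec_mulVec, h6, smul_smul, smul_smul]
  congr 1
  field_simp

theorem resetTerm_smul (RI : ℂ) (c : ℝ) (x : ι → ℝ) (φ : ℝ) (n : ℕ) :
    S.resetTerm ω RI (c • x) φ n = c * S.resetTerm ω RI x φ n := by
  have h1 : toCv (S.Θ ω *ᵥ S.Bstar ω RI (c • x)) = (c : ℂ) • toCv (S.Θ ω *ᵥ S.Bstar ω RI x) := by
    have h0 : S.Bstar ω RI (c • x) = c • S.Bstar ω RI x := by
      rw [Bstar, mulVec_smul, smul_comm, ← Bstar]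
    rw [h0, mulVec_smul]
    ext i; simp [toCv]
  rw [resetTerm, resetTerm, RDF, RDF, h1]
  split_ifs
  · rw [smul_comm, mulVec_smul, dotProduct_smul, smul_eq_mul]; ring
  · ring

theorem resetTerm_eq_mul_exp (RI : ℂ) (x : ι → ℝ) (φ ψ : ℝ) (n : ℕ) :
    S.resetTerm ω RI x φ n =
      S.resetTerm ω RI x ψ n * Complex.exp (Complex.I * (n * (φ - ψ) : ℝ)) := by
  have : Complex.exp (n * Complex.I * (S.qL ω RI).arg + n * Complex.I * φ) =
      Complex.exp (n * Complex.I * (S.qL ω RI).arg + n * Complex.I * ψ) *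
        Complex.exp (Complex.I * (n * (φ - ψ) : ℝ)) := by
    rw [← Complex.exp_add]
    congr 1; push_cast; ring
  rw [resetTerm, resetTerm, Ψ, Ψ, this]; ring

theorem resetTerm_of_odd (hω : 0 < ω) {RI : ℂ} (hΛ : IsUnit (S.Λ ω).det)
    (hΔ : IsUnit (S.Δ ω).det) (hD : IsUnit (S.ΔD ω).det) (hκ : ‖S.qL ω RI‖ ≠ 0) (x : ι → ℝ)
    (φ : ℝ) {n : ℕ} (hn : Odd n) :
    S.resetTerm ω RI x φ n = -(2 * Complex.I * ω / Real.pi) * S.G.tf (jw ω n) *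
      (S.Rδ (jw ω n) ⬝ᵥ toCv x) *
        Complex.exp (n * Complex.I * (S.qL ω RI).arg + n * Complex.I * φ) := by
  have h1 : (‖S.qL ω RI‖ : ℂ) • toCv (S.Θ ω *ᵥ S.Bstar ω RI x) =
      (-(2 * ω / Real.pi) : ℂ) • (toC (S.Aρ - 1) *ᵥ toCv x) := by
    have h2 := norm_smul_Θ_mulVec_Bstar hω hΛ hΔ hD hκ x
    have h3 : toC (S.Aρ - 1) *ᵥ toCv x = toCv ((S.Aρ - 1) *ᵥ x) := by
      ext i; exact (RingHom.map_mulVec Complex.ofRealHom _ _ i).symm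
    rw [h3]
    ext i
    have := congrArg (fun y : ℝ => (y : ℂ)) (congrFun h2 i)
    simp only [Pi.smul_apply, smul_eq_mul] at this ⊢
    push_cast at this
    exact this
  have h4 : (‖S.qL ω RI‖ : ℂ) * S.RDF ω (S.Bstar ω RI x) n =
      -(2 * Complex.I * ω / Real.pi) * (S.Rδ (jw ω n) ⬝ᵥ toCv x) := by
    rw [RDF, if_pos hn, ← smul_eq_mul, ← dotProduct_smul, ← mulVec_smul, smul_comm, h1,
      mulVec_smul, mulVec_smul, dotProduct_smul, dotProduct_smul, Rδ, RXδ, ← dotProduct_mulVec,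
      mulVec_mulVec, smul_eq_mul, smul_eq_mul]
    ring
  rw [resetTerm, Ψ]
  linear_combination (S.G.tf (jw ω n) *
    Complex.exp (n * Complex.I * (S.qL ω RI).arg + n * Complex.I * φ)) * h4

end ResetLoop
end ResetControl

/-! ### Exact harmonics and the exact reset state. -/

namespace ResetControl.ResetLoop

variable {ι γ κ ν μ : Type*} [Fintype ι] [DecidableEq ι] [Fintype γ] [DecidableEq γ]
  [Fintype κ] [DecidableEq κ] [Fintype ν] [DecidableEq ν] [Fintype μ] [DecidableEq μ]
  {S : ResetLoop ι γ κ} {ω t₀ : ℝ} {RI : ℂ}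

theorem isUnit_Δ (hω : 0 < ω) (hreg : ∀ k : ℕ, Odd k → S.Regular (jw ω k)) :
    IsUnit (S.Δ ω).det :=
  isUnit_one_add_exp hω fun n hn => (hreg n hn).1

theorem Trajectory.harmonic_e (X : S.Trajectory (sinusoid RI ω) (resetInstants ω t₀))
    (hS : S.WellPosed) (hω : 0 < ω) (hreg : ∀ k : ℕ, Odd k → S.Regular (jw ω k))
    (hper : X.HalfWavePeriodic ω) (n : ℕ) :
    harmonic X.e ω n = if Odd n then S.SL (jw ω n) * ((if n = 1 then RI else 0) -
      2 * Complex.I * ω / Real.pi * S.G.tf (jw ω n) *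
        (S.Rδ (jw ω n) ⬝ᵥ toCv (X.xR t₀)) * Complex.exp (-(jw ω n * t₀))) else 0 := by
  have hω' : (ω : ℂ) ≠ 0 := by exact_mod_cast hω.ne'
  have hpi : (Real.pi : ℂ) ≠ 0 := by exact_mod_cast Real.pi_ne_zero
  obtain ⟨x, e, q, ⟨hxc, hec, hqc⟩, hne, hlap⟩ :=
    X.exists_lap hS hω (continuous_sinusoid RI ω) hper
  rw [harmonic_eq_lap hω t₀ (X.e_add hS hper (sinusoid_add_pi_div hω RI)) hec
    fun t ht => (hne t ht.1.ne').2.1.symm]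
  split_ifs with hn h1
  · rw [(hlap n hn (hreg n hn)).1, lap_sinusoid hω t₀ hn, if_pos h1]
    field_simp
  · rw [(hlap n hn (hreg n hn)).1, lap_sinusoid hω t₀ hn, if_neg h1]
    ring
  · rfl

/-- The hypotheses say `φ ≡ π - (ω t₀ + θ₀)` modulo `2π`. An odd power preserves the minus sign
coming from `π`. -/
theorem exp_eq_neg_exp_of_phase {θ₀ φ : ℝ}
    (hs : Real.sin φ = Real.sin (ω * t₀ + θ₀)) (hc : Real.cos φ = -Real.cos (ω * t₀ + θ₀))
    {n : ℕ} (hn : Odd n) :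
    Complex.exp (n * Complex.I * θ₀ + n * Complex.I * φ) = -Complex.exp (-(jw ω n * t₀)) := by
  have h1 : Complex.exp (Complex.I * φ) = -Complex.exp (-(Complex.I * (ω * t₀ + θ₀ : ℝ))) := by
    rw [mul_comm, ← mul_neg, ← Complex.ofReal_neg, mul_comm Complex.I, Complex.exp_mul_I,
      Complex.exp_mul_I, ← Complex.ofReal_cos, ← Complex.ofReal_sin, ← Complex.ofReal_cos,
      ← Complex.ofReal_sin, Real.cos_neg, Real.sin_neg, hs, hc]
    push_cast; ring
  have h2 : Complex.exp (Complex.I * θ₀ + Complex.I * φ) =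
      -Complex.exp (-(Complex.I * ω * t₀)) := by
    rw [Complex.exp_add, h1, mul_neg, ← Complex.exp_add]
    congr 2; push_cast; ring
  rw [show n * Complex.I * θ₀ + n * Complex.I * φ =
    n * (Complex.I * θ₀ + Complex.I * φ) by ring, Complex.exp_nat_mul, h2, hn.neg_pow,
    ← Complex.exp_nat_mul]
  congr 2; rw [jw]; ring

theorem resetTerm_of_not_odd (x : ι → ℝ) (φ : ℝ) {n : ℕ} (hn : ¬ Odd n) :
    S.resetTerm ω RI x φ n = 0 := by
  rw [resetTerm, RDF, if_neg hn]; ring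

theorem errorFormula_sub (x y : ι → ℝ) (φ ψ : ℝ) (n : ℕ) :
    S.errorFormula ω RI x φ n - S.errorFormula ω RI y ψ n =
      S.SL (jw ω n) * (S.resetTerm ω RI y ψ n - S.resetTerm ω RI x φ n) := by
  rw [errorFormula, errorFormula]
  split_ifs with h
  · subst h; ring
  · ring

/-- The reset state is the cosine of the phase shift times its analytical value. -/
theorem Trajectory.xR_eq_smul_xHat (X : S.Trajectory (sinusoid RI ω) (resetInstants ω t₀))
    (hS : S.WellPosed) (hω : 0 < ω) (hreg : ∀ k : ℕ, Odd k → S.Regular (jw ω k))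
    (hper : X.HalfWavePeriodic ω)
    {AQ : Matrix ν ν ℝ} {BQ : Matrix ν ι ℝ} {CQ : ν → ℝ}
    (hQ : S.RealizesQ AQ BQ CQ) (hAQ : Hurwitz AQ)
    {AH : Matrix μ μ ℝ} {BH : Matrix μ ι ℝ} {CH : Matrix ι μ ℝ}
    (hH : S.RealizesH AH BH CH) (hAH : Hurwitz AH)
    (hM : IsUnit (S.stateMatrix AQ BQ CQ AH BH CH ω).det) :
    X.xR t₀ = (-Real.cos (ω * t₀ + (S.qL ω RI).arg)) • S.xHat AQ BQ CQ AH BH CH ω RI := by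
  have hA := (hreg 1 odd_one).1
  have hΛ := isUnit_Λ hA
  have h1 := X.sinusoid_qL_eq hS hω hreg hper hQ hAQ
  rw [sinusoid] at h1
  -- The sine in the equation for `x` equals a linear functional of `x`, so it moves to the left as
  -- the rank-one term of `stateMatrix`. No small-angle approximation enters; only the cosine
  -- remains on the right.
  have h2 : S.stateMatrix AQ BQ CQ AH BH CH ω *ᵥ X.xR t₀ =
      (-(‖S.qL ω RI‖ * Real.cos (ω * t₀ + (S.qL ω RI).arg) * ω)) • ((S.Λ ω)⁻¹ *ᵥ S.R.B) := by
    rw [stateMatrix, sub_mulVec, add_mulVec, one_mulVec, ← mulVec_mulVec, vecMulVec_mulVec,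
      ← dotProduct_mulVec, ← h1, op_smul_eq_smul, mulVec_smul, ← A_mulVec_Λ_inv hΛ]
    ext i
    have h3 := X.xR_eq hS hω hreg hper hH hAH i
    rw [sinusoid_mul_RXL hA] at h3
    simp only [Pi.add_apply, Pi.sub_apply, Pi.smul_apply, smul_eq_mul]
    linear_combination h3
  have h4 := congrArg ((S.stateMatrix AQ BQ CQ AH BH CH ω)⁻¹ *ᵥ ·) h2
  simp only [mulVec_mulVec, nonsing_inv_mul _ hM, one_mulVec, mulVec_smul] at h4
  rw [h4, xHat, mulVec_smul, smul_smul, smul_smul]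
  congr 1; ring

end ResetControl.ResetLoop

end

theorem mainTheorem1 {ι γ κ ν μ : Type*}
    [Fintype ι] [DecidableEq ι] [Fintype γ] [DecidableEq γ] [Fintype κ] [DecidableEq κ]
    [Fintype ν] [DecidableEq ν] [Fintype μ] [DecidableEq μ]
    (S : ResetLoop ι γ κ) (hS : S.WellPosed)
    (ω : ℝ) (hω : 0 < ω) (RI : ℂ)
    (hreg : ∀ k : ℕ, Odd k → S.Regular (jw ω k))
    -- state-space matrices of `Q_δ` and `H`, both asymptotically stable
    (AQ : Matrix ν ν ℝ) (BQ : Matrix ν ι ℝ) (CQ : ν → ℝ)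
    (hQ : S.RealizesQ AQ BQ CQ) (hAQ : Hurwitz AQ)
    (AH : Matrix μ μ ℝ) (BH : Matrix μ ι ℝ) (CH : Matrix ι μ ℝ)
    (hH : S.RealizesH AH BH CH) (hAH : Hurwitz AH)
    -- the inverted terms are invertible
    (hM : IsUnit (S.stateMatrix AQ BQ CQ AH BH CH ω).det)
    (hD : IsUnit (S.ΔD ω).det)
    -- periodic response with exactly two (modelled) resets per period
    (t₀ : ℝ) (X : S.Trajectory (sinusoid RI ω) (resetInstants ω t₀))
    (hper : X.HalfWavePeriodic ω)
    -- `t₀` is a descending zero crossing, in the direction predicted by the base linear system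
    (hdesc : derivWithin X.q (Set.Iic t₀) t₀ < 0)
    (hdir : SignType.sign (derivWithin X.q (Set.Iic t₀) t₀) =
      SignType.sign (deriv (sinusoid (S.qL ω RI) ω) t₀)) :
    let φ : ℝ := S.Φ AQ BQ CQ ω RI (X.xR t₀)
    let x' : ι → ℝ := S.xHat AQ BQ CQ AH BH CH ω RI
    let φ' : ℝ := S.Φ AQ BQ CQ ω RI x'
    -- the formula is exact for the actual reset state and phase shift
    (∀ n : ℕ, 1 ≤ n → harmonic X.e ω n = S.errorFormula ω RI (X.xR t₀) φ n) ∧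
    -- the analytical reset state is correct to second order in the phase shift
    (∀ i, |X.xR t₀ i - x' i| ≤ φ ^ 2 / 2 * |x' i|) ∧
    -- so is the analytical error response, if the phase shift is small
    (|φ| ≤ Real.pi / 4 → ∀ n : ℕ, 1 ≤ n →
      ‖harmonic X.e ω n - S.errorFormula ω RI x' φ' n‖ ≤
        (φ ^ 2 / 2 + 2 * n * |φ| ^ 3) * ‖S.SL (jw ω n) * S.resetTerm ω RI x' φ' n‖) := by
  intro φ x' φ'
  set P := S.qL ω RI with hP
  set θ := ω * t₀ + P.arg with hθ
  rw [sign_neg hdesc, eq_comm, sign_eq_neg_one_iff, deriv_sinusoid, ← hθ] at hdir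
  -- A zero phasor would make the base response constant, contradicting its strict descent.
  have hκ : ‖P‖ ≠ 0 := fun h => by simp [h] at hdir
  have hκ0 : 0 < ‖P‖ := lt_of_le_of_ne (norm_nonneg _) hκ.symm
  have hcos : Real.cos θ < 0 := by
    by_contra! h
    exact hdir.not_ge (by positivity)
  have hsin := X.sinusoid_qL_eq hS hω hreg hper hQ hAQ
  rw [sinusoid, ← hP, ← hθ] at hsin
  have hφ : φ = Real.arcsin (Real.sin θ) := by
    simp only [φ, ResetLoop.Φ]
    rw [← hsin, ← hP, mul_right_comm, mul_inv_cancel₀ hκ, one_mul]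
  have hφs : Real.sin φ = Real.sin θ := by
    rw [hφ, Real.sin_arcsin (Real.neg_one_le_sin _) (Real.sin_le_one _)]
  -- Descent selects the branch: the principal arcsine has nonnegative cosine, while `cos θ` is
  -- negative.
  have hφc : Real.cos φ = -Real.cos θ := by rw [hφ, cos_arcsin_sin_of_cos_neg hcos]
  have hφc0 : 0 < Real.cos φ := by linarith
  have hx : X.xR t₀ = Real.cos φ • x' := by
    rw [hφc]; exact X.xR_eq_smul_xHat hS hω hreg hper hQ hAQ hH hAH hM
  -- The argument of the arcsine is linear in the state. Passing from `x = cos φ • x'` to `x'`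
  -- divides `sin φ` by `cos φ`.
  have hφ' : φ' = Real.arcsin (Real.tan φ) := by
    rw [hx, Matrix.mulVec_smul, dotProduct_smul, smul_eq_mul, ← hφs] at hsin
    simp only [φ', ResetLoop.Φ]
    rw [← hP, Real.tan_eq_sin_div_cos]
    congr 1
    field_simp
    linarith
  have hexact : ∀ n : ℕ, 1 ≤ n → harmonic X.e ω n = S.errorFormula ω RI (X.xR t₀) φ n := by
    intro n _
    rw [X.harmonic_e hS hω hreg hper, ResetLoop.errorFormula]
    by_cases hn : Odd n
    · have hterm := ResetLoop.resetTerm_of_odd hω (ResetLoop.isUnit_Λ (hreg 1 odd_one).1) (ResetLoop.isUnit_Δ hω hreg) hD hκ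
        (X.xR t₀) φ hn
      rw [ResetLoop.exp_eq_neg_exp_of_phase hφs hφc hn] at hterm
      rw [if_pos hn]
      split_ifs with h1
      · subst h1; rw [hterm]; ring
      · rw [hterm]; ring
    · rw [if_neg hn, if_neg (by rintro rfl; exact hn odd_one), ResetLoop.resetTerm_of_not_odd _ _ hn]
      ring
  have hcos2 : 1 - Real.cos φ ≤ φ ^ 2 / 2 := by linarith [Real.one_sub_sq_div_two_le_cos (x := φ)]
  have hcos1 : 0 ≤ 1 - Real.cos φ := by linarith [Real.cos_le_one φ]
  refine ⟨hexact, fun i => ?_, fun hsmall n hn => ?_⟩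
  · have h1 : X.xR t₀ i - x' i = -((1 - Real.cos φ) * x' i) := by
      rw [hx, Pi.smul_apply, smul_eq_mul]; ring
    rw [h1, abs_neg, abs_mul, abs_of_nonneg hcos1]
    exact mul_le_mul_of_nonneg_right hcos2 (abs_nonneg _)
  · set z := Complex.exp (Complex.I * (n * (φ - φ') : ℝ)) with hz
    -- The relative error `1 - cos φ · z` is split into an amplitude part and a phase part.
    have h1 : harmonic X.e ω n - S.errorFormula ω RI x' φ' n =
        ((1 - Real.cos φ : ℝ) - (Real.cos φ : ℂ) * (z - 1)) *
          (S.SL (jw ω n) * S.resetTerm ω RI x' φ' n) := by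
      rw [hexact n hn, ResetLoop.errorFormula_sub, hx, ResetLoop.resetTerm_smul, ResetLoop.resetTerm_eq_mul_exp RI x' φ φ', ← hz]
      push_cast; ring
    rw [h1, norm_mul]
    refine mul_le_mul_of_nonneg_right ?_ (norm_nonneg _)
    have h2 : ‖z - 1‖ ≤ n * |φ' - φ| := by
      refine (Real.norm_exp_I_mul_ofReal_sub_one_le).trans_eq ?_
      rw [norm_mul, Real.norm_natCast, Real.norm_eq_abs, abs_sub_comm]
    have h3 := cos_mul_abs_arcsin_tan_sub_le hsmall
    rw [← hφ'] at h3
    calc ‖((1 - Real.cos φ : ℝ) : ℂ) - (Real.cos φ : ℂ) * (z - 1)‖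
        ≤ ‖((1 - Real.cos φ : ℝ) : ℂ)‖ + ‖(Real.cos φ : ℂ) * (z - 1)‖ := norm_sub_le _ _
      _ = (1 - Real.cos φ) + Real.cos φ * ‖z - 1‖ := by
          rw [norm_mul, Complex.norm_real, Complex.norm_real, Real.norm_of_nonneg hcos1,
            Real.norm_of_nonneg hφc0.le]
      _ ≤ φ ^ 2 / 2 + Real.cos φ * (n * |φ' - φ|) := by gcongr
      _ = φ ^ 2 / 2 + n * (Real.cos φ * |φ' - φ|) := by ring
      _ ≤ φ ^ 2 / 2 + n * (2 * |φ| ^ 3) := by gcongr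
      _ = _ := by ring
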